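/- All matrices are real. For $A\in\mathbb R^{n\times n}$, $B\in\mathbb R^{n\times m}$, $C\in\mathbb R^{m\times n}$, $D\in\mathbb R^{m\times m}$, the quadruple $(A,B,C,D)$ is a realization, of dimension $n$, of the rational matrix function $C(zI-A)^{-1}B+D$; it is minimal if no realization of the same function has smaller dimension. The McMillan degree $\deg F$ of an $m\times m$ rational function $F$ that has a realization (i.e. is proper) is the smallest dimension of its realizations. $F$ is all-pass if $F(z)F(z^{-1})^\top=I$. If $F=F_1F_2$ with $F_1,F_2$ proper real rational all-pass functions and $\deg F=\deg F_1+\deg F_2$, then $F_1$ is called a left, and $F_2$ a right, all-pass divisor of $F$. $X^+$ denotes the Moore–Penrose pseudoinverse, and $A$ is unmixed if no two (possibly equal) complex eigenvalues of $A$ have product $1$. **Theorem.** Let $Q(z)=C(zI-A)^{-1}B+D$ be a minimal realization of an $m\times m$ rational discrete-time all-pass function. Put $$M(P)=\begin{bmatrix}APA^\top-P & APC^\top\\ CPA^\top & CPC^\top+I\end{bmatrix},\qquad N(Q)=\begin{bmatrix}A^\top QA-Q & A^\top QB\\ B^\top QA & B^\top QB+I\end{bmatrix}.$$ 1. There is a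 unique $P_0=P_0^\top$ with $AP_0A^\top-P_0=BB^\top$, $BD^\top-AP_0C^\top=0$, $DD^\top-CP_0C^\top=I$, and it is non-singular. Let $\mathcal P_0$ be the set of all matrices $P=[(I-\Pi)P_0^{-1}(I-\Pi)]^+$, where $\Pi$ is the orthogonal projector onto an $A^\top$-invariant subspace of $\mathbb R^n$. Every $P\in\mathcal P_0$ is a symmetric solution of $M(P)\ge 0$, $\operatorname{rank}M(P)=m$; if $A$ is unmixed, $\mathcal P_0$ is the set of all symmetric solutions of these conditions. For each $P\in\mathcal P_0$ and all $G\in\mathbb R^{n\times m}$, $L\in\mathbb R^{m\times m}$ such that $[G^\top\mid L^\top]$ has full row rank and $M(P)=[G^\top\mid L^\top]^\top[G^\top\mid L^\top]$, the function $Q_L(z)=C(zI-A)^{-1}G+L$ is a left all-pass divisor of $Q(z)$, and its McMillan degree equals $\operatorname{rank}P$. Conversely, every left all-pass divisor of $Q(z)$ equals $C(zI-A)^{-1}G+L$ for some $P\in\mathcal P_0$ and some $G,L$ such that $[G^\top\mid L^\top]$ has full row rank and $M(P)=[G^\top\mid L^\top]^\top[G^\top\mid L^\top]$. 2. There is a unique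 $Q_0=Q_0^\top$ with $A^\top Q_0A-Q_0=C^\top C$, $C^\top D-A^\top Q_0B=0$, $D^\top D-B^\top Q_0B=I$, and it is non-singular. Let $\mathcal Q_0$ be the set of all matrices $Q=[(I-\Pi)Q_0^{-1}(I-\Pi)]^+$, where $\Pi$ is the orthogonal projector onto an $A$-invariant subspace of $\mathbb R^n$. Every $Q\in\mathcal Q_0$ is a symmetric solution of $N(Q)\ge 0$, $\operatorname{rank}N(Q)=m$; if $A$ is unmixed, $\mathcal Q_0$ is the set of all symmetric solutions of these conditions. For each $Q\in\mathcal Q_0$ and all $H\in\mathbb R^{m\times n}$, $J\in\mathbb R^{m\times m}$ such that $[H\mid J]$ has full row rank and $N(Q)=[H\mid J]^\top[H\mid J]$, the function $Q_R(z)=H(zI-A)^{-1}B+J$ is a right all-pass divisor of $Q(z)$, and its McMillan degree equals $\operatorname{rank}Q$. Conversely, every right all-pass divisor of $Q(z)$ equals $H(zI-A)^{-1}B+J$ for some $Q\in\mathcal Q_0$ and some $H,J$ such that $[H\mid J]$ has full row rank and $N(Q)=[H\mid J]^\top[H\mid J]$. -/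

import Mathlib

noncomputable section

namespace AllPass

open Matrix

/-- The transfer function `C (zI - A)⁻¹ B + D`, a matrix over the field of real rational functions
in the variable `z = RatFunc.X`. -/
def transfer {n m : ℕ} (A : Matrix (Fin n) (Fin n) ℝ) (B : Matrix (Fin n) (Fin m) ℝ)
    (C : Matrix (Fin m) (Fin n) ℝ) (D : Matrix (Fin m) (Fin m) ℝ) :
    Matrix (Fin m) (Fin m) (RatFunc ℝ) :=
  C.map RatFunc.C * ((RatFunc.X : RatFunc ℝ) • (1 : Matrix (Fin n) (Fin n) (RatFunc ℝ))
    - A.map RatFunc.C)⁻¹ * B.map RatFunc.C + D.map RatFunc.C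

/-- `F` has a state-space realization of dimension `k`. -/
def HasRealization {m : ℕ} (F : Matrix (Fin m) (Fin m) (RatFunc ℝ)) (k : ℕ) : Prop :=
  ∃ (A : Matrix (Fin k) (Fin k) ℝ) (B : Matrix (Fin k) (Fin m) ℝ)
    (C : Matrix (Fin m) (Fin k) ℝ) (D : Matrix (Fin m) (Fin m) ℝ), F = transfer A B C D

/-- `F` is realizable (equivalently, proper). -/
def Realizable {m : ℕ} (F : Matrix (Fin m) (Fin m) (RatFunc ℝ)) : Prop :=
  ∃ k, HasRealization F k

/-- McMillan degree of a realizable rational matrix: the least dimension of a realization. -/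
def mcMillanDegree {m : ℕ} (F : Matrix (Fin m) (Fin m) (RatFunc ℝ)) : ℕ :=
  sInf {k | HasRealization F k}

/-- `(A, B, C, D)` is a minimal realization of its transfer function: no realization of the same
function has smaller dimension. -/
def IsMinimalRealization {n m : ℕ} (A : Matrix (Fin n) (Fin n) ℝ) (B : Matrix (Fin n) (Fin m) ℝ)
    (C : Matrix (Fin m) (Fin n) ℝ) (D : Matrix (Fin m) (Fin m) ℝ) : Prop :=
  ∀ k, HasRealization (transfer A B C D) k → n ≤ k

/-- The conjugate `F*(z) = F(z⁻¹)ᵀ`. -/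
def conj {m : ℕ} (F : Matrix (Fin m) (Fin m) (RatFunc ℝ)) : Matrix (Fin m) (Fin m) (RatFunc ℝ) :=
  (F.map fun f => RatFunc.eval (RatFunc.C : ℝ →+* RatFunc ℝ) (RatFunc.X : RatFunc ℝ)⁻¹ f)ᵀ

/-- Discrete-time all-pass: `F(z) F*(z) = I`. -/
def IsAllPass {m : ℕ} (F : Matrix (Fin m) (Fin m) (RatFunc ℝ)) : Prop :=
  F * conj F = 1

/-- `F₁ F₂` is a minimal factorization of `F` into proper all-pass functions. -/
def IsMinimalAllPassFactorization {m : ℕ} (F F₁ F₂ : Matrix (Fin m) (Fin m) (RatFunc ℝ)) : Prop :=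
  F = F₁ * F₂ ∧ Realizable F₁ ∧ Realizable F₂ ∧ IsAllPass F₁ ∧ IsAllPass F₂ ∧
    mcMillanDegree F = mcMillanDegree F₁ + mcMillanDegree F₂

/-- `F₁` is a left all-pass divisor of `F`. -/
def IsLeftAllPassDivisor {m : ℕ} (F₁ F : Matrix (Fin m) (Fin m) (RatFunc ℝ)) : Prop :=
  ∃ F₂, IsMinimalAllPassFactorization F F₁ F₂

/-- `F₂` is a right all-pass divisor of `F`. -/
def IsRightAllPassDivisor {m : ℕ} (F₂ F : Matrix (Fin m) (Fin m) (RatFunc ℝ)) : Prop :=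
  ∃ F₁, IsMinimalAllPassFactorization F F₁ F₂

/-- `P` is a symmetric solution of the equations
`A P Aᵀ - P = B Bᵀ`, `B Dᵀ - A P Cᵀ = 0`, `D Dᵀ - C P Cᵀ = I`. -/
def IsSolP {n m : ℕ} (A : Matrix (Fin n) (Fin n) ℝ) (B : Matrix (Fin n) (Fin m) ℝ)
    (C : Matrix (Fin m) (Fin n) ℝ) (D : Matrix (Fin m) (Fin m) ℝ)
    (P : Matrix (Fin n) (Fin n) ℝ) : Prop :=
  P.IsSymm ∧ A * P * Aᵀ - P = B * Bᵀ ∧ B * Dᵀ - A * P * Cᵀ = 0 ∧ D * Dᵀ - C * P * Cᵀ = 1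

/-- `Q` is a symmetric solution of the equations
`Aᵀ Q A - Q = Cᵀ C`, `Cᵀ D - Aᵀ Q B = 0`, `Dᵀ D - Bᵀ Q B = I`. -/
def IsSolQ {n m : ℕ} (A : Matrix (Fin n) (Fin n) ℝ) (B : Matrix (Fin n) (Fin m) ℝ)
    (C : Matrix (Fin m) (Fin n) ℝ) (D : Matrix (Fin m) (Fin m) ℝ)
    (Q : Matrix (Fin n) (Fin n) ℝ) : Prop :=
  Q.IsSymm ∧ Aᵀ * Q * A - Q = Cᵀ * C ∧ Cᵀ * D - Aᵀ * Q * B = 0 ∧ Dᵀ * D - Bᵀ * Q * B = 1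

/-- The block matrix `M(P)`. -/
def lmiM {n m : ℕ} (A : Matrix (Fin n) (Fin n) ℝ) (C : Matrix (Fin m) (Fin n) ℝ)
    (P : Matrix (Fin n) (Fin n) ℝ) : Matrix (Fin n ⊕ Fin m) (Fin n ⊕ Fin m) ℝ :=
  fromBlocks (A * P * Aᵀ - P) (A * P * Cᵀ) (C * P * Aᵀ) (C * P * Cᵀ + 1)

/-- The block matrix `N(Q)`. -/
def lmiN {n m : ℕ} (A : Matrix (Fin n) (Fin n) ℝ) (B : Matrix (Fin n) (Fin m) ℝ)
    (Q : Matrix (Fin n) (Fin n) ℝ) : Matrix (Fin n ⊕ Fin m) (Fin n ⊕ Fin m) ℝ :=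
  fromBlocks (Aᵀ * Q * A - Q) (Aᵀ * Q * B) (Bᵀ * Q * A) (Bᵀ * Q * B + 1)

/-- The symmetric solutions of the constrained LMI `M(P) ≥ 0`, `rank M(P) = m`. -/
def lmiSolutionsP {n m : ℕ} (A : Matrix (Fin n) (Fin n) ℝ) (C : Matrix (Fin m) (Fin n) ℝ) :
    Set (Matrix (Fin n) (Fin n) ℝ) :=
  {P | P.IsSymm ∧ (lmiM A C P).PosSemidef ∧ (lmiM A C P).rank = m}

/-- The symmetric solutions of the constrained LMI `N(Q) ≥ 0`, `rank N(Q) = m`. -/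
def lmiSolutionsQ {n m : ℕ} (A : Matrix (Fin n) (Fin n) ℝ) (B : Matrix (Fin n) (Fin m) ℝ) :
    Set (Matrix (Fin n) (Fin n) ℝ) :=
  {Q | Q.IsSymm ∧ (lmiN A B Q).PosSemidef ∧ (lmiN A B Q).rank = m}

/-- `X` is the Moore–Penrose pseudoinverse of `S` (the four Penrose equations). -/
def IsMoorePenrose {n : ℕ} (S X : Matrix (Fin n) (Fin n) ℝ) : Prop :=
  S * X * S = S ∧ X * S * X = X ∧ (S * X).IsSymm ∧ (X * S).IsSymm

/-- `E` is the matrix of the orthogonal projector onto the subspace `Y` of `ℝⁿ`. -/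
def IsOrthProjector {n : ℕ} (E : Matrix (Fin n) (Fin n) ℝ) (Y : Submodule ℝ (Fin n → ℝ)) : Prop :=
  E.IsSymm ∧ E * E = E ∧ LinearMap.range E.mulVecLin = Y

/-- The matrices `[(I - Π) R⁻¹ (I - Π)]⁺`, where `Π` is the orthogonal projector onto a
`T`-invariant subspace of `ℝⁿ`. -/
def projFamily {n : ℕ} (T R : Matrix (Fin n) (Fin n) ℝ) : Set (Matrix (Fin n) (Fin n) ℝ) :=
  {X | ∃ (Y : Submodule ℝ (Fin n → ℝ)) (E : Matrix (Fin n) (Fin n) ℝ),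
    (∀ v ∈ Y, T *ᵥ v ∈ Y) ∧ IsOrthProjector E Y ∧ IsMoorePenrose ((1 - E) * R⁻¹ * (1 - E)) X}

/-- `A` is unmixed: it has no reciprocal pair of (complex) eigenvalues. -/
def Unmixed {n : ℕ} (A : Matrix (Fin n) (Fin n) ℝ) : Prop :=
  ∀ a ∈ spectrum ℂ (A.map Complex.ofReal), ∀ b ∈ spectrum ℂ (A.map Complex.ofReal), a * b ≠ 1

end AllPass

end

/-!
The argument runs on an indefinite Gramian. Writing a realization as a system matrix
`S = [A B; C D]`, the equations for `P₀` say `S diag(P₀, -I) Sᵀ = diag(P₀, -I)` (`Lossless`). When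
`P₀` is nonsingular this can be inverted, and `Q₀ = P₀⁻¹` solves the dual equations
(`Lossless.inv`). Rational identities are checked by evaluation at almost all real points, which
turns `transfer` into the real matrix function `tf`.

*Existence of `P₀`* (`exists_lossless`). The kernel `(F(z) F(w)ᵀ - I) / (z w - 1)` of an all-pass
function equals `C (zI - A)⁻¹ b(w)` for an explicit `b`. As it is symmetric in `z` and `w`,
observability forces `b(w) = P₀ (wI - Aᵀ)⁻¹ Cᵀ` with a constant `P₀`, and comparing coefficients
gives the equations. Uniqueness follows from observability.

*Nondegeneracy* (`isUnit_of_stein`). A symmetric solution of `Aᵀ K A - K = Cᵀ C` with `(C, A)`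
observable is nonsingular: `1` is not an eigenvalue of `A`, and the Cayley transform shows that
`ker K` is `A`-invariant and killed by `C`. Since observability passes to invariant subspaces, `Q₀`
is nondegenerate on every `A`-invariant subspace, so `projFamily Aᵀ P₀` consists of the matrices
`P = R (Rᵀ Q₀ R)⁻¹ Rᵀ` with `A R = R A'` and `R` injective (`mem_projFamily_iff`).

*From subspaces to divisors.* The pair `(C R, A')` completes to a lossless system with Gramian
`(Rᵀ Q₀ R)⁻¹` (`exists_lossless_completion`), so `M(P)` is positive semidefinite of rank `m`, and
every factorization of `M(P)` arises from such a completion (`exists_lossless_of_lmiM`). If `F₁` is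
its transfer function, then `F₁(z⁻¹)ᵀ F(z)` is again realized on the state matrix `A`, with an output
that vanishes on the invariant subspace. The degrees of the two factors are thus at most `k` and
`n - k`; subadditivity makes both bounds equalities (`isLeftAllPassDivisor_of_lossless`).

*From divisors to subspaces.* The cascade of minimal realizations of the factors is minimal, hence
isomorphic to the given realization. By uniqueness its dual Gramian is block diagonal, and the first
block gives the required `P` (`exists_invariant_of_isLeftAllPassDivisor`).

*Unmixed `A`.* The Cayley argument also shows that a symmetric solution `P` of the linear matrix
inequality has an `Aᵀ`-invariant kernel, whence `P = R P' Rᵀ` with `A R = R A'`; the rank condition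
says that `P'⁻¹` solves the same Stein equation as `Rᵀ Q₀ R`. The solution of that equation is unique
because the characteristic polynomial of an unmixed matrix is coprime to its reverse
(`Unmixed.eq_zero_of_stein`).

Right divisors are the transposes of the left divisors of the transposed function.
-/

namespace AllPass

open Matrix Filter

/-! ### Evaluation of rational matrices at real points -/

/-- Entrywise evaluation of a rational matrix at a real point, with value `0` at a pole. -/
noncomputable def evalAt {p q : Type*} (F : Matrix p q (RatFunc ℝ)) (z : ℝ) : Matrix p q ℝ :=
  F.map (RatFunc.eval (RingHom.id ℝ) z)

lemma eventually_eval_ne_zero {p : Polynomial ℝ} (hp : p ≠ 0) :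
    ∀ᶠ z in cofinite, p.eval z ≠ 0 := by
  rw [eventually_cofinite]
  simpa [Polynomial.IsRoot] using Polynomial.finite_setOfPred_isRoot hp

lemma eventually_denom_ne_zero (f : RatFunc ℝ) :
    ∀ᶠ z in cofinite, f.denom.eval₂ (RingHom.id ℝ) z ≠ 0 :=
  eventually_eval_ne_zero f.denom_ne_zero

lemma eventually_ratFunc_eval_add (f g : RatFunc ℝ) :
    ∀ᶠ z in cofinite, RatFunc.eval (RingHom.id ℝ) z (f + g) =
      RatFunc.eval (RingHom.id ℝ) z f + RatFunc.eval (RingHom.id ℝ) z g := by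
  filter_upwards [eventually_denom_ne_zero f, eventually_denom_ne_zero g] with z hf hg
  exact RatFunc.eval_add _ _ hf hg

lemma eventually_ratFunc_eval_mul (f g : RatFunc ℝ) :
    ∀ᶠ z in cofinite, RatFunc.eval (RingHom.id ℝ) z (f * g) =
      RatFunc.eval (RingHom.id ℝ) z f * RatFunc.eval (RingHom.id ℝ) z g := by
  filter_upwards [eventually_denom_ne_zero f, eventually_denom_ne_zero g] with z hf hg
  exact RatFunc.eval_mul _ _ hf hg

lemma ratFunc_eq_zero_of_eventually {f : RatFunc ℝ}
    (h : ∀ᶠ z in cofinite, RatFunc.eval (RingHom.id ℝ) z f = 0) : f = 0 := by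
  by_contra hf
  have hn : f.num ≠ 0 := by simpa using hf
  obtain ⟨z, h1, h2, h3⟩ := (h.and ((eventually_eval_ne_zero hn).and
    (eventually_denom_ne_zero f))).exists
  rw [RatFunc.eval, div_eq_zero_iff] at h1
  exact h1.elim h2 h3

lemma ratFunc_eq_of_eventually {f g : RatFunc ℝ}
    (h : ∀ᶠ z in cofinite, RatFunc.eval (RingHom.id ℝ) z f = RatFunc.eval (RingHom.id ℝ) z g) :
    f = g := by
  rw [← sub_eq_zero]
  refine ratFunc_eq_zero_of_eventually ?_
  filter_upwards [h, eventually_ratFunc_eval_add (f - g) g] with z h1 h2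
  rw [sub_add_cancel, h1] at h2
  linarith

lemma eventually_ratFunc_eval_div (f g : RatFunc ℝ) :
    ∀ᶠ z in cofinite, RatFunc.eval (RingHom.id ℝ) z (f / g) =
      RatFunc.eval (RingHom.id ℝ) z f / RatFunc.eval (RingHom.id ℝ) z g := by
  by_cases hg : g = 0
  · simp [hg]
  have hn : g.num ≠ 0 := by simpa using hg
  filter_upwards [eventually_ratFunc_eval_mul (f / g) g, eventually_eval_ne_zero hn,
    eventually_denom_ne_zero g] with z h1 h2 h3
  rw [div_mul_cancel₀ _ hg] at h1
  rw [h1, mul_div_cancel_right₀]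
  rw [RatFunc.eval]
  exact div_ne_zero h2 h3

/-- Substituting `X⁻¹` and then evaluating at `z` evaluates the polynomial at `z⁻¹`. -/
lemma eventually_eval_eval₂_inv (p : Polynomial ℝ) :
    ∀ᶠ z : ℝ in cofinite, RatFunc.eval (RingHom.id ℝ) z
      (p.eval₂ (RatFunc.C : ℝ →+* RatFunc ℝ) (RatFunc.X : RatFunc ℝ)⁻¹) = p.eval z⁻¹ := by
  induction p using Polynomial.induction_on with
  | C a => simp
  | add p q hp hq =>
    simp only [Polynomial.eval₂_add, Polynomial.eval_add]
    filter_upwards [hp, hq, eventually_ratFunc_eval_add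
      (p.eval₂ (RatFunc.C : ℝ →+* RatFunc ℝ) (RatFunc.X : RatFunc ℝ)⁻¹)
      (q.eval₂ (RatFunc.C : ℝ →+* RatFunc ℝ) (RatFunc.X : RatFunc ℝ)⁻¹)] with z h1 h2 h3
    rw [h3, h1, h2]
  | monomial k a h =>
    have e : (Polynomial.C a * Polynomial.X ^ (k + 1)).eval₂ (RatFunc.C : ℝ →+* RatFunc ℝ)
        (RatFunc.X : RatFunc ℝ)⁻¹ = (Polynomial.C a * Polynomial.X ^ k).eval₂
        (RatFunc.C : ℝ →+* RatFunc ℝ) (RatFunc.X : RatFunc ℝ)⁻¹ / RatFunc.X := by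
      simp [pow_succ, div_eq_mul_inv, mul_assoc]
    rw [e]
    filter_upwards [h, eventually_ratFunc_eval_div ((Polynomial.C a * Polynomial.X ^ k).eval₂
        (RatFunc.C : ℝ →+* RatFunc ℝ) (RatFunc.X : RatFunc ℝ)⁻¹) RatFunc.X] with z h1 h2
    rw [h2, h1]
    simp [pow_succ, div_eq_mul_inv, mul_assoc]

lemma tendsto_inv_cofinite : Tendsto (fun z : ℝ => z⁻¹) cofinite cofinite :=
  inv_injective.tendsto_cofinite

/-- Equality of rational matrices can be tested at almost all real points. -/
lemma eq_of_eventually_evalAt {p q : Type*} {F G : Matrix p q (RatFunc ℝ)}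
    (h : ∀ᶠ z in cofinite, evalAt F z = evalAt G z) : F = G := by
  ext i j
  refine ratFunc_eq_of_eventually ?_
  filter_upwards [h] with z hz
  exact congrFun (congrFun hz i) j

lemma eventually_evalAt_add {p q : Type*} [Finite p] [Finite q] (F G : Matrix p q (RatFunc ℝ)) :
    ∀ᶠ z in cofinite, evalAt (F + G) z = evalAt F z + evalAt G z := by
  have h := eventually_all.2 fun i => eventually_all.2 fun j =>
    eventually_ratFunc_eval_add (F i j) (G i j)
  filter_upwards [h] with z hz
  ext i j
  exact hz i j

lemma eventually_ratFunc_eval_sum {ι : Type*} (s : Finset ι) (f : ι → RatFunc ℝ) :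
    ∀ᶠ z in cofinite, RatFunc.eval (RingHom.id ℝ) z (∑ i ∈ s, f i) =
      ∑ i ∈ s, RatFunc.eval (RingHom.id ℝ) z (f i) := by
  classical
  induction s using Finset.induction_on with
  | empty => simp
  | insert a s ha ih =>
    simp only [Finset.sum_insert ha]
    filter_upwards [ih, eventually_ratFunc_eval_add (f a) (∑ i ∈ s, f i)] with z h1 h2
    rw [h2, h1]

lemma eventually_evalAt_mul {p q r : Type*} [Finite p] [Fintype q] [Finite r]
    (F : Matrix p q (RatFunc ℝ)) (G : Matrix q r (RatFunc ℝ)) :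
    ∀ᶠ z in cofinite, evalAt (F * G) z = evalAt F z * evalAt G z := by
  have h := eventually_all.2 fun i => eventually_all.2 fun j => eventually_all.2 fun k =>
    eventually_ratFunc_eval_mul (F i j) (G j k)
  have h' := eventually_all.2 fun i => eventually_all.2 fun k =>
    eventually_ratFunc_eval_sum Finset.univ (fun j => F i j * G j k)
  filter_upwards [h, h'] with z hz hz'
  ext i k
  simp only [evalAt, map_apply, mul_apply]
  rw [hz' i k]
  exact Finset.sum_congr rfl fun j _ => hz i j k

lemma evalAt_map_C {p q : Type*} (M : Matrix p q ℝ) (z : ℝ) :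
    evalAt (M.map (RatFunc.C : ℝ →+* RatFunc ℝ)) z = M := by
  ext i j
  simp [evalAt]

lemma evalAt_one {p : Type*} [DecidableEq p] (z : ℝ) :
    evalAt (1 : Matrix p p (RatFunc ℝ)) z = 1 := by
  ext i j
  by_cases h : i = j <;> simp [evalAt, h, one_apply, RatFunc.eval_zero, RatFunc.eval_one]

lemma eventually_evalAt_conj {m : ℕ} (F : Matrix (Fin m) (Fin m) (RatFunc ℝ)) :
    ∀ᶠ z in cofinite, evalAt (conj F) z = (evalAt F z⁻¹)ᵀ := by
  have h := eventually_all.2 fun i => eventually_all.2 fun j =>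
    (eventually_eval_eval₂_inv (F i j).num).and ((eventually_eval_eval₂_inv (F i j).denom).and
      (eventually_ratFunc_eval_div
        ((F i j).num.eval₂ (RatFunc.C : ℝ →+* RatFunc ℝ) (RatFunc.X : RatFunc ℝ)⁻¹)
        ((F i j).denom.eval₂ (RatFunc.C : ℝ →+* RatFunc ℝ) (RatFunc.X : RatFunc ℝ)⁻¹)))
  filter_upwards [h] with z hz
  ext i j
  obtain ⟨h1, h2, h3⟩ := hz j i
  rw [h1, h2] at h3
  exact h3

/-- All-pass is the pointwise identity `F(z) F(z⁻¹)ᵀ = I` at almost all real points. -/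
lemma isAllPass_iff {m : ℕ} (F : Matrix (Fin m) (Fin m) (RatFunc ℝ)) :
    IsAllPass F ↔ ∀ᶠ z in cofinite, evalAt F z * (evalAt F z⁻¹)ᵀ = 1 := by
  constructor
  · intro h
    filter_upwards [eventually_evalAt_mul F (conj F), eventually_evalAt_conj F] with z h1 h2
    rw [← h2, ← h1, h, evalAt_one]
  · intro h
    refine eq_of_eventually_evalAt ?_
    filter_upwards [eventually_evalAt_mul F (conj F), eventually_evalAt_conj F, h] with z h1 h2 h3
    rw [h1, h2, h3, evalAt_one]

/-- The transfer function `C (zI - A)⁻¹ B + D` at a real point, over arbitrary index types. -/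
noncomputable def tf {n p q : Type*} [Fintype n] [DecidableEq n] (A : Matrix n n ℝ) (B : Matrix n q ℝ)
    (C : Matrix p n ℝ) (D : Matrix p q ℝ) (z : ℝ) : Matrix p q ℝ :=
  C * (z • (1 : Matrix n n ℝ) - A)⁻¹ * B + D

/-- The resolvent matrix `zI - A` is invertible at almost all real points. -/
lemma eventually_isUnit_resolvent {n : Type*} [Fintype n] [DecidableEq n] (A : Matrix n n ℝ) :
    ∀ᶠ z : ℝ in cofinite, IsUnit (z • (1 : Matrix n n ℝ) - A).det := by
  filter_upwards [eventually_eval_ne_zero A.charpoly_monic.ne_zero] with z hz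
  rw [Matrix.eval_charpoly] at hz
  rw [isUnit_iff_ne_zero]
  convert hz using 3
  ext i j
  by_cases h : i = j <;> simp [h]

lemma eventually_evalAt_transfer {n m : ℕ} (A : Matrix (Fin n) (Fin n) ℝ)
    (B : Matrix (Fin n) (Fin m) ℝ) (C : Matrix (Fin m) (Fin n) ℝ) (D : Matrix (Fin m) (Fin m) ℝ) :
    ∀ᶠ z in cofinite, evalAt (transfer A B C D) z = tf A B C D z := by
  set R : Matrix (Fin n) (Fin n) (RatFunc ℝ) :=
    (RatFunc.X : RatFunc ℝ) • (1 : Matrix (Fin n) (Fin n) (RatFunc ℝ)) - A.map RatFunc.C with hR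
  have hRz : ∀ᶠ z in cofinite, evalAt R z = z • (1 : Matrix (Fin n) (Fin n) ℝ) - A := by
    have h := eventually_evalAt_add R (A.map RatFunc.C)
    filter_upwards [h] with z hz
    rw [evalAt_map_C, hR, sub_add_cancel] at hz
    rw [eq_sub_iff_add_eq, hR, ← hz]
    ext i j
    by_cases hij : i = j <;> simp [evalAt, hij, one_apply, RatFunc.eval_zero, RatFunc.eval_X]
  have hu : IsUnit R.det := by
    rw [isUnit_iff_ne_zero]
    intro h0
    obtain ⟨v, hv, hv0⟩ := Matrix.exists_mulVec_eq_zero_iff.2 h0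
    have h2 := eventually_evalAt_mul R (Matrix.replicateCol Unit v)
    apply hv
    ext i
    refine ratFunc_eq_zero_of_eventually ?_
    filter_upwards [h2, hRz, eventually_isUnit_resolvent A] with z h3 h4 h5
    have h6 : evalAt (R * Matrix.replicateCol Unit v) z = 0 := by
      rw [← Matrix.replicateCol_mulVec, hv0]
      ext i j
      simp [evalAt, RatFunc.eval_zero]
    rw [h6, h4] at h3
    have h7 := congrArg (fun Y => (z • (1 : Matrix (Fin n) (Fin n) ℝ) - A)⁻¹ * Y) h3
    simp only [Matrix.mul_zero, Matrix.nonsing_inv_mul_cancel_left _ _ h5] at h7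
    exact (congrFun (congrFun h7 i) ()).symm
  filter_upwards [hRz, eventually_evalAt_mul R R⁻¹,
    eventually_evalAt_mul (C.map RatFunc.C * R⁻¹) (B.map RatFunc.C),
    eventually_evalAt_mul (C.map RatFunc.C) R⁻¹,
    eventually_evalAt_add (C.map RatFunc.C * R⁻¹ * B.map RatFunc.C) (D.map RatFunc.C)]
    with z h1 h2 h3 h4 h5
  rw [Matrix.mul_nonsing_inv _ hu, evalAt_one, h1] at h2
  rw [transfer, ← hR, h5, h3, h4, evalAt_map_C, evalAt_map_C, evalAt_map_C, tf,
    Matrix.inv_eq_right_inv h2.symm]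

/-! ### Resolvents and transfer functions at real points -/

section Resolvent

variable {n k p q : Type*} [Fintype n] [DecidableEq n] [Fintype k] [DecidableEq k]

lemma tendsto_resolvent_atTop (A : Matrix n n ℝ) :
    Tendsto (fun z : ℝ => (z • (1 : Matrix n n ℝ) - A)⁻¹) atTop (nhds 0) := by
  have h1 : ContinuousAt (fun w : ℝ => w • (1 - w • A : Matrix n n ℝ)⁻¹) 0 := by
    simp only [Matrix.inv_def, Ring.inverse_eq_inv']
    have hc : Continuous fun w : ℝ => (1 - w • A : Matrix n n ℝ) := by fun_prop
    have hd : ContinuousAt (fun w : ℝ => (1 - w • A : Matrix n n ℝ).det⁻¹) 0 :=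
      hc.matrix_det.continuousAt.inv₀ (by simp)
    exact continuousAt_id.smul (hd.smul hc.matrix_adjugate.continuousAt)
  have h2 := h1.tendsto.comp tendsto_inv_atTop_zero
  simp only [zero_smul] at h2
  refine h2.congr' ?_
  filter_upwards [eventually_gt_atTop 0,
    (eventually_isUnit_resolvent A).filter_mono atTop_le_cofinite] with z hz hu
  have e : (1 - z⁻¹ • A : Matrix n n ℝ)⁻¹ = z • (z • (1 : Matrix n n ℝ) - A)⁻¹ := by
    apply Matrix.inv_eq_right_inv
    rw [Matrix.mul_smul, ← Matrix.smul_mul, smul_sub, smul_smul, mul_inv_cancel₀ hz.ne', one_smul,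
      Matrix.mul_nonsing_inv _ hu]
  simp only [Function.comp]
  rw [e, smul_smul, inv_mul_cancel₀ hz.ne', one_smul]

lemma smul_resolvent {A : Matrix n n ℝ} {z : ℝ} (h : IsUnit (z • (1 : Matrix n n ℝ) - A).det) :
    z • (z • (1 : Matrix n n ℝ) - A)⁻¹ = 1 + (z • (1 : Matrix n n ℝ) - A)⁻¹ * A := by
  have := Matrix.nonsing_inv_mul _ h
  rw [Matrix.mul_sub, Matrix.mul_smul, Matrix.mul_one] at this
  exact sub_eq_iff_eq_add.1 this

lemma tendsto_tf_atTop [Fintype p] [Fintype q] (A : Matrix n n ℝ) (B : Matrix n q ℝ)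
    (C : Matrix p n ℝ) (D : Matrix p q ℝ) : Tendsto (tf A B C D) atTop (nhds D) := by
  have h1 : Continuous fun Y : Matrix n n ℝ => C * Y * B + D := by fun_prop
  have h2 := (h1.tendsto 0).comp (tendsto_resolvent_atTop A)
  simp only [Matrix.mul_zero, Matrix.zero_mul, zero_add] at h2
  exact h2

/-- A transfer function that vanishes near infinity has zero feedthrough and zero Markov
parameters. -/
lemma markov_eq_zero [Fintype p] [Fintype q] {A : Matrix n n ℝ} {B : Matrix n q ℝ}
    {C : Matrix p n ℝ} {D : Matrix p q ℝ} (h : ∀ᶠ z in atTop, tf A B C D z = 0) :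
    D = 0 ∧ ∀ i : ℕ, C * A ^ i * B = 0 := by
  have hD : ∀ (B : Matrix n q ℝ) (D : Matrix p q ℝ),
      (∀ᶠ z in atTop, tf A B C D z = 0) → D = 0 := fun B D h =>
    tendsto_nhds_unique (tendsto_tf_atTop A B C D)
      (tendsto_const_nhds.congr' (h.mono fun z hz => hz.symm))
  -- multiplying by `z` shifts the sequence of Markov parameters
  have hshift : ∀ B : Matrix n q ℝ, (∀ᶠ z in atTop, tf A B C 0 z = 0) →
      ∀ᶠ z in atTop, tf A (A * B) C (C * B) z = 0 := by
    intro B hB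
    filter_upwards [hB, (eventually_isUnit_resolvent A).filter_mono atTop_le_cofinite] with z h1 h2
    have h3 := congrArg (fun Y => z • Y) h1
    simp only [tf, add_zero, smul_zero] at h3
    rw [← Matrix.smul_mul, ← Matrix.mul_smul, smul_resolvent h2] at h3
    rw [tf, ← h3]
    simp only [Matrix.mul_add, Matrix.add_mul, Matrix.mul_one, Matrix.mul_assoc]
    abel
  have h0 : D = 0 := hD B D h
  subst h0
  have hk : ∀ i : ℕ, ∀ᶠ z in atTop, tf A (A ^ i * B) C 0 z = 0 := by
    intro i
    induction i with
    | zero => simpa using h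
    | succ i ih =>
      have h1 := hshift _ ih
      rw [hD _ _ h1] at h1
      rwa [pow_succ', Matrix.mul_assoc]
  exact ⟨rfl, fun i => by rw [Matrix.mul_assoc]; exact hD _ _ (hshift _ (hk i))⟩

lemma resolvent_intertwine {A : Matrix n n ℝ} {A₂ : Matrix k k ℝ} {T : Matrix k n ℝ}
    (hT : T * A = A₂ * T) {z : ℝ} (h : IsUnit (z • (1 : Matrix n n ℝ) - A).det)
    (h₂ : IsUnit (z • (1 : Matrix k k ℝ) - A₂).det) :
    T * (z • (1 : Matrix n n ℝ) - A)⁻¹ = (z • (1 : Matrix k k ℝ) - A₂)⁻¹ * T := by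
  have e : T * (z • (1 : Matrix n n ℝ) - A) = (z • (1 : Matrix k k ℝ) - A₂) * T := by
    rw [Matrix.mul_sub, Matrix.sub_mul, hT]; simp
  calc T * (z • (1 : Matrix n n ℝ) - A)⁻¹
      = (z • (1 : Matrix k k ℝ) - A₂)⁻¹ * ((z • (1 : Matrix k k ℝ) - A₂) * T) *
          (z • (1 : Matrix n n ℝ) - A)⁻¹ := by rw [Matrix.nonsing_inv_mul_cancel_left _ _ h₂]
    _ = _ := by
      rw [← e, Matrix.mul_assoc, Matrix.mul_assoc, Matrix.mul_nonsing_inv _ h, Matrix.mul_one]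

/-- A matrix intertwining two state matrices carries one realization into the other. -/
lemma tf_intertwine {A : Matrix n n ℝ} {A₂ : Matrix k k ℝ} {T : Matrix k n ℝ}
    (hT : T * A = A₂ * T) (B : Matrix n q ℝ) (C : Matrix p k ℝ) (D : Matrix p q ℝ) :
    ∀ᶠ z in cofinite, tf A B (C * T) D z = tf A₂ (T * B) C D z := by
  filter_upwards [eventually_isUnit_resolvent A, eventually_isUnit_resolvent A₂] with z h h₂
  rw [tf, tf, Matrix.mul_assoc C T, resolvent_intertwine hT h h₂]
  simp only [Matrix.mul_assoc]

lemma resolvent_transpose (A : Matrix n n ℝ) (z : ℝ) :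
    ((z • (1 : Matrix n n ℝ) - A)⁻¹)ᵀ = (z • (1 : Matrix n n ℝ) - Aᵀ)⁻¹ := by
  rw [Matrix.transpose_nonsing_inv]; simp

lemma tf_transpose (A : Matrix n n ℝ) (B : Matrix n q ℝ)
    (C : Matrix p n ℝ) (D : Matrix p q ℝ) (z : ℝ) :
    (tf A B C D z)ᵀ = tf Aᵀ Cᵀ Bᵀ Dᵀ z := by
  simp [tf, Matrix.transpose_mul, resolvent_transpose, Matrix.mul_assoc]

/-- The cascade (series connection) of two systems realizes the product. -/
lemma tf_cascade {r : Type*} [Fintype r] (A₁ : Matrix n n ℝ) (B₁ : Matrix n r ℝ)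
    (C₁ : Matrix p n ℝ) (D₁ : Matrix p r ℝ) (A₂ : Matrix k k ℝ) (B₂ : Matrix k q ℝ)
    (C₂ : Matrix r k ℝ) (D₂ : Matrix r q ℝ) :
    ∀ᶠ z in cofinite, tf (fromBlocks A₁ (B₁ * C₂) 0 A₂) (fromRows (B₁ * D₂) B₂)
      (fromCols C₁ (D₁ * C₂)) (D₁ * D₂) z = tf A₁ B₁ C₁ D₁ z * tf A₂ B₂ C₂ D₂ z := by
  filter_upwards [eventually_isUnit_resolvent A₁, eventually_isUnit_resolvent A₂] with z h₁ h₂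
  have e : z • (1 : Matrix (n ⊕ k) (n ⊕ k) ℝ) - fromBlocks A₁ (B₁ * C₂) 0 A₂ =
      fromBlocks (z • (1 : Matrix n n ℝ) - A₁) (-(B₁ * C₂)) 0 (z • (1 : Matrix k k ℝ) - A₂) := by
    rw [← fromBlocks_one, fromBlocks_smul, sub_eq_add_neg, fromBlocks_neg, fromBlocks_add]
    simp [sub_eq_add_neg]
  have e' : (fromBlocks (z • (1 : Matrix n n ℝ) - A₁) (-(B₁ * C₂)) 0
      (z • (1 : Matrix k k ℝ) - A₂))⁻¹ = fromBlocks (z • (1 : Matrix n n ℝ) - A₁)⁻¹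
      ((z • (1 : Matrix n n ℝ) - A₁)⁻¹ * (B₁ * C₂) * (z • (1 : Matrix k k ℝ) - A₂)⁻¹) 0
      (z • (1 : Matrix k k ℝ) - A₂)⁻¹ := by
    apply Matrix.inv_eq_right_inv
    rw [fromBlocks_multiply, Matrix.mul_nonsing_inv _ h₁, Matrix.mul_nonsing_inv _ h₂,
      Matrix.mul_assoc _ (B₁ * C₂), Matrix.mul_nonsing_inv_cancel_left _ _ h₁]
    simp
  rw [tf, e, e', fromCols_mul_fromBlocks, fromCols_mul_fromRows, tf, tf]
  simp only [Matrix.mul_add, Matrix.add_mul, Matrix.mul_assoc, Matrix.mul_zero, add_zero]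
  abel

end Resolvent

/-! ### Realizations and their reduction -/

section Realization

lemma evalAt_transpose {p q : Type*} (F : Matrix p q (RatFunc ℝ)) (z : ℝ) :
    evalAt Fᵀ z = (evalAt F z)ᵀ := rfl

lemma hasRealization_of_tf {m : ℕ} {n : Type*} [Fintype n] [DecidableEq n]
    {F : Matrix (Fin m) (Fin m) (RatFunc ℝ)} {A : Matrix n n ℝ} {B : Matrix n (Fin m) ℝ}
    {C : Matrix (Fin m) n ℝ} {D : Matrix (Fin m) (Fin m) ℝ}
    (h : ∀ᶠ z in cofinite, evalAt F z = tf A B C D z) : HasRealization F (Fintype.card n) := by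
  let e := (Fintype.equivFin n).symm
  refine ⟨A.submatrix e e, B.submatrix e id, C.submatrix id e, D, eq_of_eventually_evalAt ?_⟩
  filter_upwards [h, eventually_evalAt_transfer (A.submatrix e e) (B.submatrix e id)
    (C.submatrix id e) D] with z h1 h2
  rw [h1, h2, tf, tf]
  have e1 : z • (1 : Matrix (Fin (Fintype.card n)) (Fin (Fintype.card n)) ℝ) - A.submatrix e e =
      (z • (1 : Matrix n n ℝ) - A).submatrix e e := by
    ext i j
    simp [one_apply]
  rw [e1, Matrix.inv_submatrix_equiv, Matrix.submatrix_mul_equiv, Matrix.submatrix_mul_equiv]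
  rfl

lemma HasRealization.transpose {m k : ℕ} {F : Matrix (Fin m) (Fin m) (RatFunc ℝ)}
    (h : HasRealization F k) : HasRealization Fᵀ k := by
  obtain ⟨A, B, C, D, rfl⟩ := h
  refine ⟨Aᵀ, Cᵀ, Bᵀ, Dᵀ, eq_of_eventually_evalAt ?_⟩
  filter_upwards [eventually_evalAt_transfer A B C D, eventually_evalAt_transfer Aᵀ Cᵀ Bᵀ Dᵀ]
    with z h1 h2
  rw [h2, evalAt_transpose, h1, tf_transpose]

lemma HasRealization.mul {m k₁ k₂ : ℕ} {F₁ F₂ : Matrix (Fin m) (Fin m) (RatFunc ℝ)}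
    (h₁ : HasRealization F₁ k₁) (h₂ : HasRealization F₂ k₂) :
    HasRealization (F₁ * F₂) (k₁ + k₂) := by
  obtain ⟨A₁, B₁, C₁, D₁, rfl⟩ := h₁
  obtain ⟨A₂, B₂, C₂, D₂, rfl⟩ := h₂
  have h : HasRealization (transfer A₁ B₁ C₁ D₁ * transfer A₂ B₂ C₂ D₂)
      (Fintype.card (Fin k₁ ⊕ Fin k₂)) := by
    refine hasRealization_of_tf (A := fromBlocks A₁ (B₁ * C₂) 0 A₂) (B := fromRows (B₁ * D₂) B₂)
      (C := fromCols C₁ (D₁ * C₂)) (D := D₁ * D₂) ?_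
    filter_upwards [eventually_evalAt_mul (transfer A₁ B₁ C₁ D₁) (transfer A₂ B₂ C₂ D₂),
      eventually_evalAt_transfer A₁ B₁ C₁ D₁, eventually_evalAt_transfer A₂ B₂ C₂ D₂,
      tf_cascade A₁ B₁ C₁ D₁ A₂ B₂ C₂ D₂] with z h1 h2 h3 h4
    rw [h1, h2, h3, h4]
  simpa using h

lemma mcMillanDegree_le {m k : ℕ} {F : Matrix (Fin m) (Fin m) (RatFunc ℝ)}
    (h : HasRealization F k) : mcMillanDegree F ≤ k := Nat.sInf_le h

lemma hasRealization_mcMillanDegree {m : ℕ} {F : Matrix (Fin m) (Fin m) (RatFunc ℝ)}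
    (h : Realizable F) : HasRealization F (mcMillanDegree F) := Nat.sInf_mem h

lemma exists_mul_eq_of_range_le {n k q : Type*} [Fintype k] [Fintype q] [DecidableEq q]
    (R : Matrix n k ℝ) (M : Matrix n q ℝ) (h : ∀ x, ∃ y, R *ᵥ y = M *ᵥ x) :
    ∃ U : Matrix k q ℝ, M = R * U := by
  choose y hy using h
  refine ⟨Matrix.of fun i j => y (Pi.single j 1) i, ?_⟩
  ext i j
  have := congrFun (hy (Pi.single j 1)) i
  rw [Matrix.mulVec_single_one] at this
  exact this.symm

/-- A basis of a subspace, arranged as the columns of an injective matrix. -/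
lemma exists_basis_matrix {n : Type*} [Fintype n] (V : Submodule ℝ (n → ℝ)) :
    ∃ R : Matrix n (Fin (Module.finrank ℝ V)) ℝ, Function.Injective R.mulVec ∧
      ∀ x, x ∈ V ↔ ∃ y, R *ᵥ y = x := by
  classical
  let b := Module.finBasis ℝ V
  let f : (Fin (Module.finrank ℝ V) → ℝ) →ₗ[ℝ] (n → ℝ) := V.subtype ∘ₗ b.equivFun.symm.toLinearMap
  have hf : ∀ y, (LinearMap.toMatrix' f) *ᵥ y = f y := fun y => LinearMap.toMatrix'_mulVec f y
  refine ⟨LinearMap.toMatrix' f, fun y y' h => ?_, fun x => ⟨fun hx => ?_, ?_⟩⟩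
  · rw [hf, hf] at h
    exact b.equivFun.symm.injective (Subtype.ext h)
  · exact ⟨b.equivFun ⟨x, hx⟩, by rw [hf]; simp [f]⟩
  · rintro ⟨y, rfl⟩
    rw [hf]
    exact (b.equivFun.symm y).2

/-- Coordinates on the quotient by the column space of an injective matrix `R`: a surjection `L₂`
with kernel the column space, a section `R₂` of it and the resulting splitting of the identity. -/
lemma exists_complement {n : Type*} [Fintype n] [DecidableEq n] {k : ℕ} (R : Matrix n (Fin k) ℝ)
    (hR : Function.Injective R.mulVec) :
    ∃ (L₂ : Matrix (Fin (Fintype.card n - k)) n ℝ) (R₂ : Matrix n (Fin (Fintype.card n - k)) ℝ)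
      (L₁ : Matrix (Fin k) n ℝ), L₂ * R = 0 ∧ L₂ * R₂ = 1 ∧ 1 - R₂ * L₂ = R * L₁ := by
  let V := LinearMap.range R.mulVecLin
  have hV : Module.finrank ℝ V = k := by
    have := LinearMap.finrank_range_of_inj (f := R.mulVecLin) hR
    simpa using this
  have hq : Module.finrank ℝ ((n → ℝ) ⧸ V) =
      Module.finrank ℝ (Fin (Fintype.card n - k) → ℝ) := by
    rw [Submodule.finrank_quotient, hV]; simp
  let e := LinearEquiv.ofFinrankEq _ _ hq
  let f := e.toLinearMap ∘ₗ V.mkQ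
  have hf : LinearMap.range f = ⊤ := by
    rw [LinearMap.range_eq_top]
    exact e.surjective.comp V.mkQ_surjective
  have hker : ∀ x, f x = 0 → ∃ y, R *ᵥ y = x := by
    intro x hx
    have : V.mkQ x = 0 := e.injective (by simpa [f] using hx)
    have : x ∈ V := by simpa using this
    exact this
  obtain ⟨g, hg⟩ := f.exists_rightInverse_of_surjective hf
  obtain ⟨L₁, hL₁⟩ := exists_mul_eq_of_range_le R
      (1 - LinearMap.toMatrix' g * LinearMap.toMatrix' f) (by
    intro x
    apply hker
    have : f (g (f x)) = f x := congrArg (fun h => h (f x)) hg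
    rw [Matrix.sub_mulVec, Matrix.one_mulVec, ← Matrix.mulVec_mulVec,
      LinearMap.toMatrix'_mulVec, LinearMap.toMatrix'_mulVec, map_sub, this, sub_self])
  refine ⟨LinearMap.toMatrix' f, LinearMap.toMatrix' g, L₁, ?_, ?_, hL₁⟩
  · apply Matrix.toLin'.injective
    refine LinearMap.ext fun x => ?_
    rw [Matrix.toLin'_mul, Matrix.toLin'_toMatrix', LinearMap.comp_apply]
    have : Matrix.toLin' R x ∈ V := ⟨x, rfl⟩
    have h0 : V.mkQ (Matrix.toLin' R x) = 0 := by simpa using this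
    simp only [f, LinearMap.comp_apply, h0, map_zero, LinearMap.zero_apply]
  · rw [← LinearMap.toMatrix'_comp, hg, LinearMap.toMatrix'_id]

/-- An invariant subspace on which the output vanishes can be divided out of a realization. -/
lemma hasRealization_sub {m k : ℕ} {n : Type*} [Fintype n] [DecidableEq n]
    {F : Matrix (Fin m) (Fin m) (RatFunc ℝ)} {A : Matrix n n ℝ} {B : Matrix n (Fin m) ℝ}
    {C : Matrix (Fin m) n ℝ} {D : Matrix (Fin m) (Fin m) ℝ}
    (h : ∀ᶠ z in cofinite, evalAt F z = tf A B C D z) {R : Matrix n (Fin k) ℝ}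
    (hR : Function.Injective R.mulVec) {A' : Matrix (Fin k) (Fin k) ℝ} (hA : A * R = R * A')
    (hC : C * R = 0) : HasRealization F (Fintype.card n - k) := by
  obtain ⟨L₂, R₂, L₁, h1, -, h3⟩ := exists_complement R hR
  have hid : (1 : Matrix n n ℝ) = R₂ * L₂ + R * L₁ := by rw [← h3]; abel
  have hLA : L₂ * A = L₂ * A * R₂ * L₂ := by
    have : L₂ * A * (R * L₁) = 0 := by
      rw [← Matrix.mul_assoc, Matrix.mul_assoc L₂, hA, ← Matrix.mul_assoc, h1]; simp
    conv_lhs => rw [← Matrix.mul_one (L₂ * A), hid, Matrix.mul_add, this]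
    simp only [add_zero, Matrix.mul_assoc]
  have hCL : C = C * R₂ * L₂ := by
    conv_lhs => rw [← Matrix.mul_one C, hid, Matrix.mul_add, ← Matrix.mul_assoc C R, hC]
    simp only [Matrix.zero_mul, add_zero, Matrix.mul_assoc]
  have h4 := tf_intertwine hLA B (C * R₂) D
  rw [← hCL] at h4
  have h5 : HasRealization F (Fintype.card (Fin (Fintype.card n - k))) :=
    hasRealization_of_tf (A := L₂ * A * R₂) (B := L₂ * B) (C := C * R₂) (D := D) (by
      filter_upwards [h, h4] with z h5 h6
      rw [h5, h6])
  simpa using h5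

end Realization

/-! ### Observability and the state-space homomorphism theorem -/

section Observability

variable {n k p q : Type*} [Fintype n] [DecidableEq n] [Fintype k] [DecidableEq k]

/-- The pair `(C, A)` is observable: no nonzero state has vanishing output `C Aⁱ x` for all `i`.
Controllability of `(A, B)` is expressed throughout as observability of `(Bᵀ, Aᵀ)`. -/
def Observable (A : Matrix n n ℝ) (C : Matrix p n ℝ) : Prop :=
  ∀ x : n → ℝ, (∀ i : ℕ, C *ᵥ (A ^ i *ᵥ x) = 0) → x = 0

lemma Observable.eq_zero {A : Matrix n n ℝ} {C : Matrix p n ℝ} (h : Observable A C)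
    {M : Matrix n q ℝ} (hM : ∀ i : ℕ, C * A ^ i * M = 0) : M = 0 := by
  have : ∀ j, M.col j = 0 := by
    intro j
    apply h
    intro i
    rw [Matrix.mulVec_mulVec]
    ext l
    exact congrFun (congrFun (hM i) l) j
  ext i j
  exact congrFun (this j) i

lemma Observable.eq_zero_left {A : Matrix n n ℝ} {B : Matrix n p ℝ} (h : Observable Aᵀ Bᵀ)
    {M : Matrix q n ℝ} (hM : ∀ i : ℕ, M * A ^ i * B = 0) : M = 0 := by
  rw [← Matrix.transpose_eq_zero]
  apply h.eq_zero
  intro i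
  rw [← Matrix.transpose_eq_zero]
  simpa [Matrix.transpose_mul, Matrix.mul_assoc] using hM i

lemma pow_intertwine {A : Matrix n n ℝ} {A' : Matrix k k ℝ} {R : Matrix n k ℝ}
    (hA : A * R = R * A') (i : ℕ) : A ^ i * R = R * A' ^ i := by
  induction i with
  | zero => simp
  | succ i ih => rw [pow_succ, Matrix.mul_assoc, hA, ← Matrix.mul_assoc, ih, pow_succ,
      Matrix.mul_assoc]

/-- Observability restricts to invariant subspaces. -/
lemma Observable.restrict {A : Matrix n n ℝ} {C : Matrix p n ℝ} (h : Observable A C)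
    {R : Matrix n k ℝ} (hR : Function.Injective R.mulVec) {A' : Matrix k k ℝ}
    (hA : A * R = R * A') : Observable A' (C * R) := by
  intro x hx
  have : R *ᵥ x = 0 := by
    apply h
    intro i
    rw [Matrix.mulVec_mulVec _ _ R, pow_intertwine hA, ← hx i]
    simp only [Matrix.mulVec_mulVec, Matrix.mul_assoc]
  exact hR (by simpa using this)

/-- The unobservable subspace of a minimal realization is zero, since it can be divided out. -/
lemma observable_of_minimal {m : ℕ} {F : Matrix (Fin m) (Fin m) (RatFunc ℝ)} {A : Matrix n n ℝ}
    {B : Matrix n (Fin m) ℝ} {C : Matrix (Fin m) n ℝ} {D : Matrix (Fin m) (Fin m) ℝ}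
    (h : ∀ᶠ z in cofinite, evalAt F z = tf A B C D z)
    (hmin : ∀ k, HasRealization F k → Fintype.card n ≤ k) : Observable A C := by
  let V : Submodule ℝ (n → ℝ) := ⨅ i : ℕ, LinearMap.ker (C * A ^ i).mulVecLin
  have hV : ∀ x, x ∈ V ↔ ∀ i : ℕ, C *ᵥ (A ^ i *ᵥ x) = 0 := by
    intro x
    simp [V, Submodule.mem_iInf, Matrix.mulVec_mulVec]
  obtain ⟨R, hR, hRV⟩ := exists_basis_matrix V
  obtain ⟨A', hA'⟩ := exists_mul_eq_of_range_le R (A * R) (by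
    intro x
    rw [← hRV, hV]
    intro i
    have := (hV (R *ᵥ x)).1 ((hRV _).2 ⟨x, rfl⟩) (i + 1)
    rw [← this, pow_succ]
    simp only [Matrix.mulVec_mulVec, Matrix.mul_assoc])
  have hC : C * R = 0 := by
    apply Matrix.toLin'.injective
    refine LinearMap.ext fun x => ?_
    have := (hV (R *ᵥ x)).1 ((hRV _).2 ⟨x, rfl⟩) 0
    simpa [Matrix.mulVec_mulVec, -Matrix.toLin'_mul] using this
  have h1 := hmin _ (hasRealization_sub h hR hA' hC)
  have h2 : Module.finrank ℝ V ≤ Fintype.card n := by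
    simpa using Submodule.finrank_le V
  intro x hx
  by_contra hx0
  have h3 : 0 < Module.finrank ℝ V :=
    Module.finrank_pos_iff_exists_ne_zero.2 ⟨⟨x, (hV x).2 hx⟩, fun h => hx0 (congrArg (·.1) h)⟩
  omega

lemma controllable_of_minimal {m : ℕ} {F : Matrix (Fin m) (Fin m) (RatFunc ℝ)} {A : Matrix n n ℝ}
    {B : Matrix n (Fin m) ℝ} {C : Matrix (Fin m) n ℝ} {D : Matrix (Fin m) (Fin m) ℝ}
    (h : ∀ᶠ z in cofinite, evalAt F z = tf A B C D z)
    (hmin : ∀ k, HasRealization F k → Fintype.card n ≤ k) : Observable Aᵀ Bᵀ := by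
  refine observable_of_minimal (F := Fᵀ) (B := Cᵀ) (D := Dᵀ) ?_ fun k hk => hmin k ?_
  · filter_upwards [h] with z hz
    rw [evalAt_transpose, hz, tf_transpose]
  · simpa using hk.transpose

omit [DecidableEq k] in
/-- A family of matrices with jointly spanning columns can be mapped by a single matrix `T` to a
second family, provided that the images `c j * b i` under a jointly injective family `c` depend only
on the columns `a i`, through matrices `d j`. -/
lemma exists_matrix_map {ι κ s r : Type*} [Fintype s] [DecidableEq s] (a : ι → Matrix n s ℝ)
    (b : ι → Matrix k s ℝ) (c : κ → Matrix r k ℝ) (d : κ → Matrix r n ℝ)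
    (ha : ∀ x : n → ℝ, (∀ i, x ᵥ* a i = 0) → x = 0) (hc : ∀ y, (∀ j, c j *ᵥ y = 0) → y = 0)
    (h : ∀ i j, c j * b i = d j * a i) : ∃ T : Matrix k n ℝ, ∀ i, T * a i = b i := by
  let Φ : (ι × s →₀ ℝ) →ₗ[ℝ] (n → ℝ) := Finsupp.linearCombination ℝ fun t => (a t.1).col t.2
  let Ψ : (ι × s →₀ ℝ) →ₗ[ℝ] (k → ℝ) := Finsupp.linearCombination ℝ fun t => (b t.1).col t.2
  have hΦ : LinearMap.range Φ = ⊤ := by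
    by_contra hne
    obtain ⟨f, hf0, hf⟩ := Submodule.exists_le_ker_of_lt_top _ (lt_top_iff_ne_top.2 hne)
    apply hf0
    have hfx : ∀ y, f y = (fun i => f (Pi.single i 1)) ⬝ᵥ y := by
      intro y
      conv_lhs => rw [pi_eq_sum_univ' y, map_sum]
      simp only [map_smul, dotProduct, smul_eq_mul]
      exact Finset.sum_congr rfl fun i _ => mul_comm _ _
    have hx := ha (fun i => f (Pi.single i 1)) (by
      intro i
      ext j
      have : f (Φ (Finsupp.single (i, j) 1)) = 0 := hf ⟨_, rfl⟩
      simp only [Φ, Finsupp.linearCombination_single, one_smul] at this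
      rw [hfx] at this
      exact this)
    ext y
    simp [hx ▸ hfx _]
  obtain ⟨g, hg⟩ := Φ.exists_rightInverse_of_surjective hΦ
  have hcd : ∀ j u, c j *ᵥ Ψ u = d j *ᵥ Φ u := by
    intro j u
    have : (c j).mulVecLin ∘ₗ Ψ = (d j).mulVecLin ∘ₗ Φ := by
      ext t
      simp only [LinearMap.comp_apply, Finsupp.lsingle_apply, Φ, Ψ,
        Finsupp.linearCombination_single, one_smul, Matrix.mulVecLin_apply]
      exact congrFun (congrFun (h t.1 j) _) t.2
    exact congrArg (fun f => f u) this
  have hT : ∀ u, Ψ (g (Φ u)) = Ψ u := by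
    intro u
    rw [← sub_eq_zero]
    apply hc
    intro j
    have : Φ (g (Φ u)) = Φ u := congrArg (fun f => f (Φ u)) hg
    rw [Matrix.mulVec_sub, hcd, hcd, this, sub_self]
  refine ⟨LinearMap.toMatrix' (Ψ ∘ₗ g), fun i => ?_⟩
  ext l j
  have := congrFun (hT (Finsupp.single (i, j) 1)) l
  simp only [Φ, Ψ, Finsupp.linearCombination_single, one_smul] at this
  change _ = b i l j at this
  rw [← this]
  change ((LinearMap.toMatrix' (Ψ ∘ₗ g)) *ᵥ ((a i).col j)) l = _
  rw [LinearMap.toMatrix'_mulVec]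
  rfl

/-- State-space homomorphism theorem: if two systems have the same Markov parameters, the first is
observable and the second controllable, then the second maps to the first. -/
lemma exists_state_map [Fintype q] [DecidableEq q] {A : Matrix n n ℝ} {B : Matrix n q ℝ}
    {C : Matrix p n ℝ} {A₂ : Matrix k k ℝ} {B₂ : Matrix k q ℝ} {C₂ : Matrix p k ℝ}
    (hobs : Observable A C) (hctr : Observable A₂ᵀ B₂ᵀ)
    (h : ∀ i : ℕ, C * A ^ i * B = C₂ * A₂ ^ i * B₂) :
    ∃ T : Matrix n k ℝ, A * T = T * A₂ ∧ T * B₂ = B ∧ C * T = C₂ := by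
  obtain ⟨T, hT⟩ := exists_matrix_map (fun i : ℕ => A₂ ^ i * B₂) (fun i : ℕ => A ^ i * B)
    (fun j : ℕ => C * A ^ j) (fun j : ℕ => C₂ * A₂ ^ j) (by
      intro x hx
      apply hctr
      intro i
      rw [← hx i, ← Matrix.transpose_pow, Matrix.mulVec_mulVec, ← Matrix.transpose_mul,
        Matrix.mulVec_transpose]) (by
      intro y hy
      apply hobs
      intro i
      rw [Matrix.mulVec_mulVec]
      exact hy i) (by
      intro i j
      have := h (j + i)
      rw [pow_add, pow_add] at this
      simpa only [Matrix.mul_assoc] using this)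
  refine ⟨T, ?_, by simpa using hT 0, ?_⟩
  · rw [← sub_eq_zero]
    apply hctr.eq_zero_left
    intro i
    have h1 := hT (i + 1)
    rw [Matrix.sub_mul, Matrix.sub_mul, Matrix.mul_assoc, Matrix.mul_assoc, hT,
      Matrix.mul_assoc, Matrix.mul_assoc, ← Matrix.mul_assoc A₂, ← pow_succ', h1, pow_succ',
      Matrix.mul_assoc, sub_self]
  · rw [← sub_eq_zero]
    apply hctr.eq_zero_left
    intro i
    rw [Matrix.sub_mul, Matrix.sub_mul, Matrix.mul_assoc, Matrix.mul_assoc, hT, ← h,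
      Matrix.mul_assoc, sub_self]

/-- Systems agreeing almost everywhere have the same feedthrough and Markov parameters. -/
lemma markov_eq [Fintype p] [Fintype q] {A : Matrix n n ℝ} {B : Matrix n q ℝ}
    {C : Matrix p n ℝ} {D : Matrix p q ℝ} {A₂ : Matrix k k ℝ} {B₂ : Matrix k q ℝ}
    {C₂ : Matrix p k ℝ} {D₂ : Matrix p q ℝ}
    (h : ∀ᶠ z in cofinite, tf A B C D z = tf A₂ B₂ C₂ D₂ z) :
    D = D₂ ∧ ∀ i : ℕ, C * A ^ i * B = C₂ * A₂ ^ i * B₂ := by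
  -- the difference is realized by the parallel connection
  have h1 : ∀ᶠ z in atTop, tf (fromBlocks A 0 0 A₂) (fromRows B B₂) (fromCols C (-C₂)) (D - D₂) z
      = 0 := by
    filter_upwards [h.filter_mono atTop_le_cofinite,
      (eventually_isUnit_resolvent A).filter_mono atTop_le_cofinite,
      (eventually_isUnit_resolvent A₂).filter_mono atTop_le_cofinite] with z h1 h2 h3
    have e : z • (1 : Matrix (n ⊕ k) (n ⊕ k) ℝ) - fromBlocks A 0 0 A₂ =
        fromBlocks (z • (1 : Matrix n n ℝ) - A) 0 0 (z • (1 : Matrix k k ℝ) - A₂) := by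
      rw [← fromBlocks_one, fromBlocks_smul, sub_eq_add_neg, fromBlocks_neg, fromBlocks_add]
      simp [sub_eq_add_neg]
    have e' : (fromBlocks (z • (1 : Matrix n n ℝ) - A) 0 0 (z • (1 : Matrix k k ℝ) - A₂))⁻¹ =
        fromBlocks (z • (1 : Matrix n n ℝ) - A)⁻¹ 0 0 (z • (1 : Matrix k k ℝ) - A₂)⁻¹ := by
      apply Matrix.inv_eq_right_inv
      rw [fromBlocks_multiply, Matrix.mul_nonsing_inv _ h2, Matrix.mul_nonsing_inv _ h3]
      simp
    rw [tf, tf] at h1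
    rw [tf, e, e', fromCols_mul_fromBlocks, fromCols_mul_fromRows]
    simp only [Matrix.mul_zero, add_zero, zero_add, Matrix.neg_mul]
    rw [← sub_eq_zero] at h1
    rw [← h1]
    abel
  obtain ⟨h2, h3⟩ := markov_eq_zero h1
  refine ⟨sub_eq_zero.1 h2, fun i => ?_⟩
  have h4 := h3 i
  have e : (fromBlocks A 0 0 A₂) ^ i = fromBlocks (A ^ i) 0 0 (A₂ ^ i) := by
    induction i with
    | zero => simp
    | succ i ih => rw [pow_succ, ih (h3 i), fromBlocks_multiply]; simp [pow_succ]
  rw [e, fromCols_mul_fromBlocks, fromCols_mul_fromRows] at h4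
  simp only [Matrix.mul_zero, add_zero, zero_add, Matrix.neg_mul] at h4
  rwa [← sub_eq_add_neg, sub_eq_zero] at h4

end Observability

/-! ### Stein equations -/

section Stein

variable {n p q : Type*} [Fintype n] [DecidableEq n] [Fintype p] [Fintype q]

omit [DecidableEq n] in
lemma transpose_mul_self_mulVec_eq_zero_iff (C : Matrix p n ℝ) (v : n → ℝ) :
    (Cᵀ * C) *ᵥ v = 0 ↔ C *ᵥ v = 0 := by
  have := Matrix.conjTranspose_mul_self_mulVec_eq_zero C v
  rwa [Matrix.conjTranspose_eq_transpose_of_trivial] at this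

lemma isUnit_det_of_mulVec {M : Matrix n n ℝ} (h : ∀ v, M *ᵥ v = 0 → v = 0) : IsUnit M.det := by
  rw [isUnit_iff_ne_zero]
  intro h0
  obtain ⟨v, hv, hv0⟩ := Matrix.exists_mulVec_eq_zero_iff.2 h0
  exact hv (h v hv0)

lemma mulVec_eq_zero_of_isUnit {M : Matrix n n ℝ} (h : IsUnit M.det) {v : n → ℝ}
    (hv : M *ᵥ v = 0) : v = 0 := by
  have := congrArg (fun x => M⁻¹ *ᵥ x) hv
  simpa [Matrix.mulVec_mulVec, Matrix.nonsing_inv_mul _ h] using this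

/-- A state matrix with a Stein equation `Aᵀ K A - K = Cᵀ C` and an observable output does not have
the eigenvalue `1`: an eigenvector `v` would give `C v = 0`. -/
lemma isUnit_sub_one {A K : Matrix n n ℝ} {C : Matrix p n ℝ} (h : Aᵀ * K * A - K = Cᵀ * C)
    (hobs : Observable A C) : IsUnit (A - 1).det := by
  apply isUnit_det_of_mulVec
  intro v hv
  have hv : A *ᵥ v = v := by
    rwa [Matrix.sub_mulVec, Matrix.one_mulVec, sub_eq_zero] at hv
  have hC : C *ᵥ v = 0 := by
    have h1 : v ⬝ᵥ ((Aᵀ * K * A - K) *ᵥ v) = 0 := by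
      rw [Matrix.sub_mulVec, ← Matrix.mulVec_mulVec, hv, ← Matrix.mulVec_mulVec, dotProduct_sub,
        Matrix.dotProduct_mulVec, Matrix.vecMul_transpose, hv, sub_self]
    rw [h, ← Matrix.mulVec_mulVec, Matrix.dotProduct_mulVec, Matrix.vecMul_transpose] at h1
    exact dotProduct_self_eq_zero.1 h1
  apply hobs
  intro i
  have : A ^ i *ᵥ v = v := by
    induction i with
    | zero => simp
    | succ i ih => rw [pow_succ, ← Matrix.mulVec_mulVec, hv, ih]
  rw [this, hC]

/-- If `Aᵀ K A - K` is positive semidefinite and `1` is not an eigenvalue of `A`, then `ker K` is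
`A`-invariant and killed by `Aᵀ K A - K`. This is the Cayley transform in disguise: the map
`(A - I)⁻¹` turns the Stein inequality into a Lyapunov inequality, for which the claim is clear. -/
lemma ker_invariant {A K : Matrix n n ℝ} (hK : K.IsSymm) (hA : IsUnit (A - 1).det)
    (hS : (Aᵀ * K * A - K).PosSemidef) {v : n → ℝ} (hv : K *ᵥ v = 0) :
    K *ᵥ (A *ᵥ v) = 0 ∧ (Aᵀ * K * A - K) *ᵥ v = 0 := by
  have key : ∀ u, K *ᵥ ((A - 1) *ᵥ u) = 0 → K *ᵥ u = 0 ∧ (Aᵀ * K * A - K) *ᵥ u = 0 := by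
    intro u hu
    have hu' : K *ᵥ (A *ᵥ u) = K *ᵥ u := by
      rwa [Matrix.sub_mulVec, Matrix.one_mulVec, Matrix.mulVec_sub, sub_eq_zero] at hu
    have hKt : ∀ x y : n → ℝ, x ⬝ᵥ (K *ᵥ y) = (K *ᵥ x) ⬝ᵥ y := by
      intro x y
      rw [Matrix.dotProduct_mulVec, ← Matrix.mulVec_transpose, hK.eq]
    have h0 : u ⬝ᵥ ((Aᵀ * K * A - K) *ᵥ u) = 0 := by
      rw [Matrix.sub_mulVec, ← Matrix.mulVec_mulVec, ← Matrix.mulVec_mulVec, dotProduct_sub,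
        Matrix.dotProduct_mulVec, Matrix.vecMul_transpose, hu', hKt, hu', ← hKt, sub_self]
    have h1 : (Aᵀ * K * A - K) *ᵥ u = 0 := by
      rw [← hS.dotProduct_mulVec_zero_iff]
      simpa using h0
    refine ⟨?_, h1⟩
    have hA' : IsUnit ((A - 1)ᵀ).det := by rwa [Matrix.det_transpose]
    apply mulVec_eq_zero_of_isUnit hA'
    rw [Matrix.sub_mulVec, ← Matrix.mulVec_mulVec, ← Matrix.mulVec_mulVec, hu'] at h1
    rw [Matrix.transpose_sub, Matrix.transpose_one, Matrix.sub_mulVec, Matrix.one_mulVec, h1]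
  -- `(A - I)⁻¹` maps `ker K` injectively, hence onto, itself
  let N := LinearMap.ker K.mulVecLin
  have hN : ∀ x ∈ N, (A - 1)⁻¹.mulVecLin x ∈ N := by
    intro x hx
    have hx' : K *ᵥ x = 0 := hx
    refine (key ((A - 1)⁻¹ *ᵥ x) ?_).1
    rw [Matrix.mulVec_mulVec _ (A - 1), Matrix.mul_nonsing_inv _ hA, Matrix.one_mulVec, hx']
  let f := (A - 1)⁻¹.mulVecLin.restrict hN
  have hf : Function.Injective f := by
    rw [injective_iff_map_eq_zero]
    intro x hx
    have h1 : (A - 1)⁻¹ *ᵥ (x : n → ℝ) = 0 := congrArg Subtype.val hx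
    exact Subtype.ext (mulVec_eq_zero_of_isUnit (Matrix.isUnit_nonsing_inv_det _ hA) h1)
  obtain ⟨u, hu⟩ := LinearMap.injective_iff_surjective.1 hf ⟨v, hv⟩
  have hu1 : (A - 1)⁻¹ *ᵥ (u : n → ℝ) = v := congrArg Subtype.val hu
  have hu2 : (A - 1) *ᵥ v = u := by
    rw [← hu1, Matrix.mulVec_mulVec, Matrix.mul_nonsing_inv _ hA, Matrix.one_mulVec]
  have hu3 : K *ᵥ (u : n → ℝ) = 0 := u.2
  refine ⟨?_, (key v (by rw [hu2, hu3])).2⟩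
  rwa [← hu2, Matrix.sub_mulVec, Matrix.one_mulVec, Matrix.mulVec_sub, hv, sub_zero] at hu3

/-- A symmetric solution of a Stein equation with observable output is nonsingular. -/
lemma isUnit_of_stein {A K : Matrix n n ℝ} {C : Matrix p n ℝ} (hK : K.IsSymm)
    (h : Aᵀ * K * A - K = Cᵀ * C) (hobs : Observable A C) : IsUnit K := by
  have hA := isUnit_sub_one h hobs
  have hS : (Aᵀ * K * A - K).PosSemidef := by
    rw [h, ← Matrix.conjTranspose_eq_transpose_of_trivial]
    exact Matrix.posSemidef_conjTranspose_mul_self C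
  rw [Matrix.isUnit_iff_isUnit_det]
  apply isUnit_det_of_mulVec
  intro v hv
  have hi : ∀ i : ℕ, K *ᵥ (A ^ i *ᵥ v) = 0 := by
    intro i
    induction i with
    | zero => simpa using hv
    | succ i ih =>
      rw [pow_succ', ← Matrix.mulVec_mulVec]
      exact (ker_invariant hK hA hS ih).1
  apply hobs
  intro i
  have := (ker_invariant hK hA hS (hi i)).2
  rwa [h, transpose_mul_self_mulVec_eq_zero_iff] at this

end Stein

/-! ### Lossless systems and the Gramian of an all-pass function -/

section Lossless

variable {n m : Type*} [Fintype n] [DecidableEq n] [Fintype m] [DecidableEq m]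

/-- `P` is a symmetric solution of the equations saying that the system matrix `[A B; C D]`
preserves `diag(P, -I)`. The dual equations for `Q` are `Lossless Aᵀ Cᵀ Bᵀ Dᵀ Q`. -/
structure Lossless (A : Matrix n n ℝ) (B : Matrix n m ℝ) (C : Matrix m n ℝ) (D : Matrix m m ℝ)
    (P : Matrix n n ℝ) : Prop where
  symm : P.IsSymm
  state : A * P * Aᵀ - P = B * Bᵀ
  cross : A * P * Cᵀ = B * Dᵀ
  output : D * Dᵀ - C * P * Cᵀ = 1

variable {A : Matrix n n ℝ} {B : Matrix n m ℝ} {C : Matrix m n ℝ} {D : Matrix m m ℝ}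
  {P : Matrix n n ℝ}

omit [DecidableEq n] in
lemma Lossless.cross' (h : Lossless A B C D P) : C * P * Aᵀ = D * Bᵀ := by
  have := congrArg transpose h.cross
  simpa [Matrix.transpose_mul, Matrix.mul_assoc, h.symm.eq] using this

/-- Inverting `S diag(P, -I) Sᵀ = diag(P, -I)` gives `Sᵀ diag(P⁻¹, -I) S = diag(P⁻¹, -I)`. -/
lemma Lossless.inv (h : Lossless A B C D P) (hP : IsUnit P) : Lossless Aᵀ Cᵀ Bᵀ Dᵀ P⁻¹ := by
  rw [Matrix.isUnit_iff_isUnit_det] at hP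
  let S := fromBlocks A B C D
  let J := fromBlocks P 0 0 (-1 : Matrix m m ℝ)
  let J' := fromBlocks P⁻¹ 0 0 (-1 : Matrix m m ℝ)
  have hJ : J * J' = 1 := by
    simp [J, J', fromBlocks_multiply, Matrix.mul_nonsing_inv _ hP]
  have hS : S * J * Sᵀ = J := by
    have h1 : A * P * Aᵀ - B * Bᵀ = P := by rw [← h.state]; abel
    have h2 : C * P * Cᵀ - D * Dᵀ = -1 := by rw [← h.output]; abel
    simp [S, J, fromBlocks_multiply, fromBlocks_transpose, ← sub_eq_add_neg, h1, h2, h.cross,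
      h.cross']
  have h1 : S * (J * Sᵀ * J') = 1 := by rw [← Matrix.mul_assoc, ← Matrix.mul_assoc, hS, hJ]
  have h2 : Sᵀ * J' * S = J' := by
    have h3 := mul_eq_one_comm.1 h1
    have hJ' := mul_eq_one_comm.1 hJ
    calc Sᵀ * J' * S = (J' * J) * (Sᵀ * J' * S) := by rw [hJ', Matrix.one_mul]
      _ = J' * (J * Sᵀ * J' * S) := by simp only [Matrix.mul_assoc]
      _ = J' := by rw [h3, Matrix.mul_one]
  simp only [S, J', fromBlocks_multiply, fromBlocks_transpose, Matrix.mul_zero, add_zero, zero_add,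
    Matrix.mul_neg, Matrix.neg_mul, Matrix.mul_one] at h2
  obtain ⟨e1, e2, -, e4⟩ := fromBlocks_inj.1 h2
  rw [← sub_eq_add_neg] at e2 e4
  refine ⟨h.symm.inv, ?_, ?_, ?_⟩ <;> simp only [Matrix.transpose_transpose]
  · rw [sub_eq_iff_eq_add, add_comm, ← sub_eq_iff_eq_add, sub_eq_add_neg, e1]
  · exact sub_eq_zero.1 e2
  · rw [← neg_sub, e4, neg_neg]

/-- The key product formula: with `Q` the dual solution, `F₁(z⁻¹)ᵀ F(z)` is again realized on the
state matrix `A`, for every `F₁ = C (zI - A)⁻¹ G + L`. -/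
lemma Lossless.tf_inv_transpose_mul_tf {r : Type*} [Fintype r] {Q : Matrix n n ℝ}
    (h : Lossless Aᵀ Cᵀ Bᵀ Dᵀ Q) (G : Matrix n r ℝ) (L : Matrix m r ℝ) :
    ∀ᶠ z in cofinite, (tf A G C L z⁻¹)ᵀ * tf A B C D z =
      tf A B (Lᵀ * C - Gᵀ * Q * A) (Lᵀ * D - Gᵀ * Q * B) z := by
  filter_upwards [eventually_isUnit_resolvent A,
    tendsto_inv_cofinite.eventually (eventually_isUnit_resolvent Aᵀ),
    (Set.finite_singleton (0 : ℝ)).eventually_cofinite_notMem] with z h1 h2 hz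
  have hz : z ≠ 0 := hz
  have hs := h.state
  have hc := h.cross
  simp only [Matrix.transpose_transpose] at hs hc
  rw [tf_transpose]
  set X := (z • (1 : Matrix n n ℝ) - A)⁻¹ with hX
  set Y := (z⁻¹ • (1 : Matrix n n ℝ) - Aᵀ)⁻¹ with hY
  have e1 : Y * (Aᵀ * Q * A - Q) * X = -(Q * A * X) - z⁻¹ • (Y * Q) := by
    have : Aᵀ * Q * A - Q = -((z⁻¹ • (1 : Matrix n n ℝ) - Aᵀ) * (Q * A)) -
        z⁻¹ • (Q * (z • (1 : Matrix n n ℝ) - A)) := by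
      simp only [Matrix.sub_mul, Matrix.mul_sub, Matrix.smul_mul, Matrix.one_mul, Matrix.mul_smul,
        Matrix.mul_one, smul_sub, smul_smul, inv_mul_cancel₀ hz, one_smul, Matrix.mul_assoc]
      abel
    rw [this, Matrix.mul_sub, Matrix.sub_mul, Matrix.mul_neg, Matrix.neg_mul,
      Matrix.nonsing_inv_mul_cancel_left _ _ h2, Matrix.mul_smul, Matrix.smul_mul,
      Matrix.mul_assoc Y, Matrix.mul_assoc Q (z • 1 - A), Matrix.mul_nonsing_inv _ h1,
      Matrix.mul_one, Matrix.mul_assoc Q]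
  have e2 : Y * (Aᵀ * Q * B) = -(Q * B) + z⁻¹ • (Y * Q * B) := by
    have : Y * Aᵀ = -1 + z⁻¹ • Y := by
      have := Matrix.nonsing_inv_mul _ h2
      rw [← hY, Matrix.mul_sub, Matrix.mul_smul, Matrix.mul_one] at this
      rw [← this]; abel
    rw [← Matrix.mul_assoc, ← Matrix.mul_assoc, this]
    simp [Matrix.add_mul, Matrix.mul_assoc]
  rw [hs] at e1
  rw [hc] at e2
  calc tf Aᵀ Cᵀ Gᵀ Lᵀ z⁻¹ * tf A B C D z
      = Gᵀ * (Y * (Cᵀ * C) * X) * B + Gᵀ * (Y * (Cᵀ * D)) + Lᵀ * C * X * B + Lᵀ * D := by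
        simp only [tf, ← hX, ← hY, Matrix.add_mul, Matrix.mul_add, Matrix.mul_assoc]
        abel
    _ = _ := by
      rw [e1, e2]
      simp only [tf, ← hX, Matrix.mul_add, Matrix.sub_mul, Matrix.mul_sub,
        Matrix.mul_neg, Matrix.neg_mul, Matrix.mul_smul, Matrix.smul_mul, Matrix.mul_assoc]
      abel

lemma Lossless.tf_mul_tf_inv_transpose {Q : Matrix n n ℝ} (h : Lossless Aᵀ Cᵀ Bᵀ Dᵀ Q) :
    ∀ᶠ z in cofinite, tf A B C D z * (tf A B C D z⁻¹)ᵀ = 1 := by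
  filter_upwards [h.tf_inv_transpose_mul_tf B D] with z hz
  have hc := h.cross'
  have ho := h.output
  simp only [Matrix.transpose_transpose] at hc ho
  rw [hc, ho, sub_self] at hz
  rw [mul_eq_one_comm, hz]
  simp [tf]

omit [Fintype m] [DecidableEq m] in
/-- The homogeneous lossless equations have only the zero solution: they force all products
`C Aⁱ Δ (Aᵀ)ʲ Cᵀ` to vanish. -/
lemma eq_zero_of_stein_homogeneous {Δ : Matrix n n ℝ} (hobs : Observable A C)
    (h1 : A * Δ * Aᵀ = Δ) (h2 : A * Δ * Cᵀ = 0) (h3 : C * Δ * Aᵀ = 0) (h4 : C * Δ * Cᵀ = 0) :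
    Δ = 0 := by
  have key : ∀ i j : ℕ, C * A ^ i * (Δ * Aᵀ ^ j * Cᵀ) = 0 := by
    intro i
    induction i with
    | zero =>
      intro j
      cases j with
      | zero => simpa [Matrix.mul_assoc] using h4
      | succ j =>
        have : C * A ^ 0 * (Δ * Aᵀ ^ (j + 1) * Cᵀ) = C * Δ * Aᵀ * (Aᵀ ^ j * Cᵀ) := by
          simp [pow_succ', Matrix.mul_assoc]
        rw [this, h3, Matrix.zero_mul]
    | succ i ih =>
      intro j
      cases j with
      | zero =>
        have : C * A ^ (i + 1) * (Δ * Aᵀ ^ 0 * Cᵀ) = C * A ^ i * (A * Δ * Cᵀ) := by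
          simp [pow_succ, Matrix.mul_assoc]
        rw [this, h2, Matrix.mul_zero]
      | succ j =>
        have : C * A ^ (i + 1) * (Δ * Aᵀ ^ (j + 1) * Cᵀ) =
            C * A ^ i * (A * Δ * Aᵀ * Aᵀ ^ j * Cᵀ) := by
          rw [pow_succ, pow_succ']; simp only [Matrix.mul_assoc]
        rw [this, h1, ih]
  have hobs' : Observable Aᵀᵀ Cᵀᵀ := hobs
  exact hobs'.eq_zero_left fun j => hobs.eq_zero fun i => key i j

lemma Lossless.unique {P' : Matrix n n ℝ} (hobs : Observable A C) (h : Lossless A B C D P)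
    (h' : Lossless A B C D P') : P = P' := by
  rw [← sub_eq_zero]
  apply eq_zero_of_stein_homogeneous (A := A) (C := C) hobs
  · rw [Matrix.mul_sub, Matrix.sub_mul, ← sub_eq_zero]
    have := h.state.trans h'.state.symm
    rw [← sub_eq_zero] at this
    rw [← this]; abel
  · rw [Matrix.mul_sub, Matrix.sub_mul, h.cross, h'.cross, sub_self]
  · rw [Matrix.mul_sub, Matrix.sub_mul, h.cross', h'.cross', sub_self]
  · have := h.output.trans h'.output.symm
    rw [Matrix.mul_sub, Matrix.sub_mul]
    rw [sub_right_inj] at this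
    rw [this, sub_self]

lemma Lossless.isUnit (hctr : Observable Aᵀ Bᵀ) (h : Lossless A B C D P) : IsUnit P :=
  isUnit_of_stein (A := Aᵀ) (C := Bᵀ) h.symm h.state hctr

/-- The Gramian of an all-pass function. It is the matrix `P` for which
`(F(z) F(w)ᵀ - I) / (z w - 1) = C (zI - A)⁻¹ P (wI - Aᵀ)⁻¹ Cᵀ`; by the all-pass property the left
side is `C (zI - A)⁻¹ b(w)` with `b(w) = -w⁻¹ (w⁻¹ I - A)⁻¹ B F(w)ᵀ`, and its symmetry in `z` and `w`
shows that `b(w)` is a fixed linear image of `(wI - Aᵀ)⁻¹ Cᵀ`. -/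
lemma exists_lossless (hobs : Observable A C)
    (hap : ∀ᶠ z in cofinite, tf A B C D z * (tf A B C D z⁻¹)ᵀ = 1) :
    ∃ P, Lossless A B C D P := by
  -- points beyond `1` are used, so that `z w - 1` never vanishes
  have hgood : ∀ᶠ w : ℝ in atTop, 1 < w ∧ IsUnit (w • (1 : Matrix n n ℝ) - A).det ∧
      IsUnit (w⁻¹ • (1 : Matrix n n ℝ) - A).det ∧ tf A B C D w⁻¹ * (tf A B C D w)ᵀ = 1 := by
    have h3 := tendsto_inv_cofinite.eventually hap
    simp only [inv_inv] at h3
    exact (eventually_gt_atTop 1).and ((eventually_isUnit_resolvent A).and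
      ((tendsto_inv_cofinite.eventually (eventually_isUnit_resolvent A)).and h3)
      |>.filter_mono atTop_le_cofinite)
  obtain ⟨M, hM⟩ := eventually_atTop.1 hgood
  let a : ℝ → Matrix n m ℝ := fun w => (w • (1 : Matrix n n ℝ) - Aᵀ)⁻¹ * Cᵀ
  let b : ℝ → Matrix n m ℝ := fun w =>
    -(w⁻¹ • ((w⁻¹ • (1 : Matrix n n ℝ) - A)⁻¹ * B * (tf A B C D w)ᵀ))
  have ha : ∀ w, (a w)ᵀ = C * (w • (1 : Matrix n n ℝ) - A)⁻¹ := by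
    intro w
    simp only [a]
    rw [← resolvent_transpose, Matrix.transpose_mul, Matrix.transpose_transpose,
      Matrix.transpose_transpose]
  have hker : ∀ z w, M ≤ z → M ≤ w →
      (z * w - 1) • ((a z)ᵀ * b w) = tf A B C D z * (tf A B C D w)ᵀ - 1 := by
    intro z w hz hw
    obtain ⟨-, hz1, -, -⟩ := hM z hz
    obtain ⟨hw0, -, hw1, hw2⟩ := hM w hw
    rw [← hw2, ← Matrix.sub_mul, ha]
    have hw0' : w ≠ 0 := by positivity
    have e : (z * w - 1) * w⁻¹ = z - w⁻¹ := by field_simp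
    have hres : (w⁻¹ - z) • ((z • (1 : Matrix n n ℝ) - A)⁻¹ * (w⁻¹ • (1 : Matrix n n ℝ) - A)⁻¹) =
        (z • (1 : Matrix n n ℝ) - A)⁻¹ - (w⁻¹ • (1 : Matrix n n ℝ) - A)⁻¹ := by
      have e1 : (w⁻¹ - z) • (1 : Matrix n n ℝ) =
          (w⁻¹ • (1 : Matrix n n ℝ) - A) - (z • (1 : Matrix n n ℝ) - A) := by
        rw [sub_smul]; abel
      calc (w⁻¹ - z) • ((z • (1 : Matrix n n ℝ) - A)⁻¹ * (w⁻¹ • (1 : Matrix n n ℝ) - A)⁻¹)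
          = (z • (1 : Matrix n n ℝ) - A)⁻¹ * ((w⁻¹ - z) • (1 : Matrix n n ℝ)) *
              (w⁻¹ • (1 : Matrix n n ℝ) - A)⁻¹ := by simp
        _ = _ := by
          rw [e1, Matrix.mul_sub, Matrix.sub_mul, Matrix.mul_assoc,
            Matrix.mul_nonsing_inv _ hw1, Matrix.nonsing_inv_mul _ hz1, Matrix.mul_one,
            Matrix.one_mul]
    have hd : tf A B C D z - tf A B C D w⁻¹ = C * ((w⁻¹ - z) •
        ((z • (1 : Matrix n n ℝ) - A)⁻¹ * (w⁻¹ • (1 : Matrix n n ℝ) - A)⁻¹)) * B := by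
      rw [hres, tf, tf]
      simp only [Matrix.mul_sub, Matrix.sub_mul]
      abel
    rw [hd]
    simp only [b, Matrix.mul_neg, Matrix.mul_smul, Matrix.smul_mul, smul_neg, smul_smul, e,
      Matrix.mul_assoc]
    rw [← neg_smul, neg_sub]
  obtain ⟨P, hP⟩ := exists_matrix_map (fun w : {w : ℝ // M ≤ w} => a w)
    (fun w : {w : ℝ // M ≤ w} => b w) (fun z : {w : ℝ // M ≤ w} => (a z)ᵀ)
    (fun z : {w : ℝ // M ≤ w} => (b z)ᵀ)
    (by
      intro x hx
      apply hobs
      have h1 : ∀ᶠ z in atTop, tf A (replicateCol Unit x) C 0 z = 0 := by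
        filter_upwards [eventually_ge_atTop M] with z hz
        have h2 := hx ⟨z, hz⟩
        rw [← Matrix.mulVec_transpose, ha] at h2
        rw [tf, add_zero, ← Matrix.replicateCol_mulVec, h2]
        rfl
      intro i
      have h3 := (markov_eq_zero h1).2 i
      rw [← Matrix.replicateCol_mulVec] at h3
      rw [Matrix.mulVec_mulVec]
      ext j
      exact congrFun (congrFun h3 j) ())
    (by
      intro x hx
      apply hobs
      have h1 : ∀ᶠ z in atTop, tf A (replicateCol Unit x) C 0 z = 0 := by
        filter_upwards [eventually_ge_atTop M] with z hz
        have h2 := hx ⟨z, hz⟩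
        rw [ha] at h2
        rw [tf, add_zero, ← Matrix.replicateCol_mulVec, h2]
        rfl
      intro i
      have h3 := (markov_eq_zero h1).2 i
      rw [← Matrix.replicateCol_mulVec] at h3
      rw [Matrix.mulVec_mulVec]
      ext j
      exact congrFun (congrFun h3 j) ())
    (by
      rintro ⟨w, hw⟩ ⟨z, hz⟩
      have h1 := hker z w hz hw
      have h2 := congrArg transpose (hker w z hw hz)
      rw [Matrix.transpose_smul, Matrix.transpose_mul, Matrix.transpose_transpose,
        Matrix.transpose_sub, Matrix.transpose_mul, Matrix.transpose_transpose,
        Matrix.transpose_one, ← h1, mul_comm w z] at h2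
      have h3 : z * w - 1 ≠ 0 := by nlinarith [(hM z hz).1, (hM w hw).1]
      exact (smul_right_injective _ h3 h2).symm)
  have hwa : ∀ᶠ w in atTop, w • a w = Cᵀ + Aᵀ * a w ∧ P * a w = b w ∧
      tf A B C D w⁻¹ * (tf A B C D w)ᵀ = 1 ∧ (tf A B C D w)ᵀ = Dᵀ + Bᵀ * a w ∧
      b w - w • (A * b w) = -(B * (tf A B C D w)ᵀ) ∧
      C * (w⁻¹ • (1 : Matrix n n ℝ) - A)⁻¹ * B * (tf A B C D w)ᵀ = -(w • (C * b w)) := by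
    filter_upwards [eventually_ge_atTop M] with w hw
    obtain ⟨h0, h1, h2, h3⟩ := hM w hw
    have h0' : w ≠ 0 := by positivity
    have h1' : IsUnit (w • (1 : Matrix n n ℝ) - Aᵀ).det := by
      have : w • (1 : Matrix n n ℝ) - Aᵀ = (w • (1 : Matrix n n ℝ) - A)ᵀ := by simp
      rwa [this, Matrix.det_transpose]
    refine ⟨?_, hP ⟨w, hw⟩, h3, ?_, ?_, ?_⟩
    · have : (w • (1 : Matrix n n ℝ) - Aᵀ) * a w = Cᵀ :=
        Matrix.mul_nonsing_inv_cancel_left _ _ h1'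
      rw [Matrix.sub_mul, Matrix.smul_mul, Matrix.one_mul] at this
      exact sub_eq_iff_eq_add.1 this
    · rw [tf_transpose, tf, add_comm, Matrix.mul_assoc]
    · have : (w⁻¹ • (1 : Matrix n n ℝ) - A) * b w = -(w⁻¹ • (B * (tf A B C D w)ᵀ)) := by
        simp only [b, Matrix.mul_neg, Matrix.mul_smul, Matrix.mul_assoc]
        rw [Matrix.mul_nonsing_inv_cancel_left _ _ h2]
      have := congrArg (fun Y => w • Y) this
      simpa [Matrix.sub_mul, smul_sub, smul_smul, h0'] using this
    · simp only [b, Matrix.mul_neg, Matrix.mul_smul, smul_neg, neg_neg, smul_smul,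
        mul_inv_cancel₀ h0', one_smul, Matrix.mul_assoc]
  have hobs' : Observable Aᵀᵀ Cᵀᵀ := hobs
  obtain ⟨e1, e2⟩ := markov_eq_zero (A := Aᵀ) (B := Cᵀ) (C := P - A * P * Aᵀ + B * Bᵀ)
    (D := B * Dᵀ - A * P * Cᵀ) (by
      filter_upwards [hwa] with w hw
      obtain ⟨h1, h2, h3, h4, h5, -⟩ := hw
      rw [h4, ← h2, ← Matrix.mul_smul, ← Matrix.mul_smul, h1, ← sub_eq_zero] at h5
      rw [tf, Matrix.mul_assoc, ← h5]
      simp only [Matrix.add_mul, Matrix.mul_add, Matrix.sub_mul, Matrix.mul_assoc, a]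
      abel)
  obtain ⟨e3, e4⟩ := markov_eq_zero (A := Aᵀ) (B := Cᵀ) (C := D * Bᵀ - C * P * Aᵀ)
    (D := D * Dᵀ - C * P * Cᵀ - 1) (by
      filter_upwards [hwa] with w hw
      obtain ⟨h1, h2, h3, h4, -, h6⟩ := hw
      nth_rewrite 1 [tf] at h3
      rw [Matrix.add_mul, h6, h4, ← h2, ← Matrix.mul_smul, ← Matrix.mul_smul, h1,
        ← sub_eq_zero] at h3
      rw [tf, Matrix.mul_assoc, ← h3]
      simp only [Matrix.mul_add, Matrix.sub_mul, Matrix.mul_assoc, a]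
      abel)
  have f1 := hobs'.eq_zero_left e2
  have f3 := hobs'.eq_zero_left e4
  have g1 : A * P * Aᵀ - P = B * Bᵀ := by rw [← sub_eq_zero, ← neg_eq_zero, ← f1]; abel
  have g2 : A * P * Cᵀ = B * Dᵀ := (sub_eq_zero.1 e1).symm
  have g3 : C * P * Aᵀ = D * Bᵀ := (sub_eq_zero.1 f3).symm
  have g4 : D * Dᵀ - C * P * Cᵀ = 1 := sub_eq_zero.1 e3
  refine ⟨P, ?_, g1, g2, g4⟩
  -- the transpose of a solution is a solution, so uniqueness gives symmetry
  have t1 := congrArg transpose g1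
  have t2 := congrArg transpose g2
  have t3 := congrArg transpose g3
  have t4 := congrArg transpose g4
  simp only [Matrix.transpose_sub, Matrix.transpose_mul, Matrix.transpose_transpose,
    Matrix.transpose_one, ← Matrix.mul_assoc] at t1 t2 t3 t4
  have h0 : Pᵀ - P = 0 := by
    apply eq_zero_of_stein_homogeneous (A := A) (C := C) hobs
    · rw [Matrix.mul_sub, Matrix.sub_mul, ← sub_eq_zero]
      have := t1.trans g1.symm
      rw [← sub_eq_zero] at this
      rw [← this]; abel
    · rw [Matrix.mul_sub, Matrix.sub_mul, t3, g2, sub_self]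
    · rw [Matrix.mul_sub, Matrix.sub_mul, t2, g3, sub_self]
    · have := t4.trans g4.symm
      rw [sub_right_inj] at this
      rw [Matrix.mul_sub, Matrix.sub_mul, this, sub_self]
  exact sub_eq_zero.1 h0

end Lossless

/-! ### Pseudoinverses of compressions and the projector family -/

section Compression

lemma exists_leftInverse_of_injective {n k : Type*} [Fintype n] [DecidableEq n] [Fintype k]
    [DecidableEq k] {R : Matrix n k ℝ} (hR : Function.Injective R.mulVec) :
    ∃ U : Matrix k n ℝ, U * R = 1 ∧ (R * U).IsSymm := by
  have h : IsUnit (Rᵀ * R).det := by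
    apply isUnit_det_of_mulVec
    intro v hv
    rw [transpose_mul_self_mulVec_eq_zero_iff] at hv
    exact hR (by simpa using hv)
  refine ⟨(Rᵀ * R)⁻¹ * Rᵀ, by rw [Matrix.mul_assoc, Matrix.nonsing_inv_mul _ h], ?_⟩
  have hs : ((Rᵀ * R)⁻¹)ᵀ = (Rᵀ * R)⁻¹ := by
    rw [Matrix.transpose_nonsing_inv, Matrix.transpose_mul, Matrix.transpose_transpose]
  simp [Matrix.IsSymm, Matrix.transpose_mul, Matrix.mul_assoc, hs]

lemma IsMoorePenrose.unique {n : ℕ} {S X Y : Matrix (Fin n) (Fin n) ℝ} (hX : IsMoorePenrose S X)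
    (hY : IsMoorePenrose S Y) : X = Y := by
  obtain ⟨x1, x2, x3, x4⟩ := hX
  obtain ⟨y1, y2, y3, y4⟩ := hY
  have e1 : S * X = S * Y := by
    calc S * X = (S * X)ᵀ := x3.eq.symm
      _ = (S * Y * (S * X))ᵀ := by rw [← Matrix.mul_assoc, y1]
      _ = S * X * S * Y := by rw [Matrix.transpose_mul, x3.eq, y3.eq, ← Matrix.mul_assoc]
      _ = S * Y := by rw [x1]
  have e2 : X * S = Y * S := by
    calc X * S = (X * S)ᵀ := x4.eq.symm
      _ = (X * S * (Y * S))ᵀ := by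
        rw [Matrix.mul_assoc, ← Matrix.mul_assoc S, y1]
      _ = Y * (S * X * S) := by
        rw [Matrix.transpose_mul, x4.eq, y4.eq]; simp only [Matrix.mul_assoc]
      _ = Y * S := by rw [x1]
  calc X = X * S * X := x2.symm
    _ = Y * S * Y := by rw [e2, Matrix.mul_assoc, e1, Matrix.mul_assoc]
    _ = Y := y2

/-- The pseudoinverse of the compression `F Q F` of a form `Q` to the column space of `R`, when the
restricted form `Rᵀ Q R` is nonsingular and `F` is the orthogonal projector onto that space. -/
lemma isMoorePenrose_compression {n k : ℕ} {F Q : Matrix (Fin n) (Fin n) ℝ}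
    {R : Matrix (Fin n) (Fin k) ℝ} {U : Matrix (Fin k) (Fin n) ℝ} (hF : F.IsSymm)
    (hFU : F = R * U) (hFR : F * R = R) (hu : IsUnit (Rᵀ * Q * R).det) :
    IsMoorePenrose (F * Q * F) (R * (Rᵀ * Q * R)⁻¹ * Rᵀ) := by
  have hRF : Rᵀ * F = Rᵀ := by
    have := congrArg transpose hFR
    rwa [Matrix.transpose_mul, hF.eq] at this
  have hFU' : F = Uᵀ * Rᵀ := by rw [← Matrix.transpose_mul, ← hFU, hF.eq]
  have hFF : F * F = F := by
    nth_rewrite 2 [hFU]; rw [← Matrix.mul_assoc, hFR, ← hFU]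
  have e1 : F * Q * F * (R * (Rᵀ * Q * R)⁻¹ * Rᵀ) = F := by
    calc F * Q * F * (R * (Rᵀ * Q * R)⁻¹ * Rᵀ)
        = F * Q * (F * R) * (Rᵀ * Q * R)⁻¹ * Rᵀ := by simp only [Matrix.mul_assoc]
      _ = Uᵀ * ((Rᵀ * Q * R) * (Rᵀ * Q * R)⁻¹) * Rᵀ := by
        rw [hFR]; nth_rewrite 1 [hFU']; simp only [Matrix.mul_assoc]
      _ = F := by rw [Matrix.mul_nonsing_inv _ hu, Matrix.mul_one, ← hFU']
  have e2 : R * (Rᵀ * Q * R)⁻¹ * Rᵀ * (F * Q * F) = F := by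
    calc R * (Rᵀ * Q * R)⁻¹ * Rᵀ * (F * Q * F)
        = R * (Rᵀ * Q * R)⁻¹ * (Rᵀ * F) * Q * F := by simp only [Matrix.mul_assoc]
      _ = R * ((Rᵀ * Q * R)⁻¹ * (Rᵀ * Q * R)) * U := by
        rw [hRF]; nth_rewrite 1 [hFU]; simp only [Matrix.mul_assoc]
      _ = F := by rw [Matrix.nonsing_inv_mul _ hu, Matrix.mul_one, ← hFU]
  refine ⟨?_, ?_, ?_, ?_⟩
  · rw [e1, ← Matrix.mul_assoc, ← Matrix.mul_assoc, hFF]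
  · rw [e2]; simp only [← Matrix.mul_assoc, hFR]
  · rwa [e1]
  · rwa [e2]

/-- Parametrization of `projFamily Aᵀ P₀`: its members are the matrices `R (Rᵀ P₀⁻¹ R)⁻¹ Rᵀ`, where
the columns of `R` form a basis of an `A`-invariant subspace. That subspace is the orthogonal
complement of the `Aᵀ`-invariant one. -/
lemma mem_projFamily_iff {n : ℕ} {A P₀ : Matrix (Fin n) (Fin n) ℝ}
    (hu : ∀ (k : ℕ) (R : Matrix (Fin n) (Fin k) ℝ) (A' : Matrix (Fin k) (Fin k) ℝ),
      Function.Injective R.mulVec → A * R = R * A' → IsUnit (Rᵀ * P₀⁻¹ * R).det)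
    {X : Matrix (Fin n) (Fin n) ℝ} :
    X ∈ projFamily Aᵀ P₀ ↔ ∃ (k : ℕ) (R : Matrix (Fin n) (Fin k) ℝ) (A' : Matrix (Fin k) (Fin k) ℝ),
      Function.Injective R.mulVec ∧ A * R = R * A' ∧ X = R * (Rᵀ * P₀⁻¹ * R)⁻¹ * Rᵀ := by
  constructor
  · rintro ⟨Y, E, hY, ⟨hE, hEE, hEY⟩, hX⟩
    obtain ⟨R, hR, hRV⟩ := exists_basis_matrix (LinearMap.range (1 - E).mulVecLin)
    have hmem : ∀ x, (∃ y, R *ᵥ y = x) ↔ ∃ y, (1 - E) *ᵥ y = x := fun x => (hRV x).symm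
    obtain ⟨U, hU⟩ := exists_mul_eq_of_range_le R (1 - E) fun x => (hmem _).2 ⟨x, rfl⟩
    obtain ⟨V, hV⟩ := exists_mul_eq_of_range_le (1 - E) R fun x => (hmem _).1 ⟨x, rfl⟩
    have hFF : (1 - E) * (1 - E) = 1 - E := by
      rw [Matrix.mul_sub, Matrix.mul_one, Matrix.sub_mul, Matrix.one_mul, hEE]; simp
    have hFR : (1 - E) * R = R := by rw [hV, ← Matrix.mul_assoc, hFF]
    have hinv : E * Aᵀ * E = Aᵀ * E := by
      apply Matrix.toLin'.injective
      refine LinearMap.ext fun x => ?_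
      have h1 : E *ᵥ x ∈ Y := by rw [← hEY]; exact ⟨x, rfl⟩
      have h2 := hY _ h1
      rw [← hEY] at h2
      obtain ⟨y, hy⟩ := h2
      have hy : E *ᵥ y = Aᵀ *ᵥ (E *ᵥ x) := hy
      rw [Matrix.toLin'_apply, Matrix.toLin'_apply, ← Matrix.mulVec_mulVec, ← Matrix.mulVec_mulVec,
        ← Matrix.mulVec_mulVec, ← hy, Matrix.mulVec_mulVec, hEE]
    have hinv' : E * A * E = E * A := by
      have := congrArg transpose hinv
      simpa [Matrix.transpose_mul, hE.eq, Matrix.mul_assoc] using this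
    have hEAR : E * (A * R) = 0 := by
      rw [hV, ← Matrix.mul_assoc, ← Matrix.mul_assoc, Matrix.mul_sub, Matrix.mul_one, hinv',
        sub_self, Matrix.zero_mul]
    have hAR : A * R = R * (U * (A * R)) := by
      rw [← Matrix.mul_assoc, ← hU, Matrix.sub_mul, Matrix.one_mul, hEAR, sub_zero]
    refine ⟨_, R, U * (A * R), hR, hAR, ?_⟩
    refine hX.unique (isMoorePenrose_compression ?_ hU hFR (hu _ R _ hR hAR))
    simp [Matrix.IsSymm, hE.eq]
  · rintro ⟨k, R, A', hR, hA, rfl⟩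
    obtain ⟨U, hU, hUs⟩ := exists_leftInverse_of_injective hR
    have hRR : R * U * (R * U) = R * U := by
      rw [Matrix.mul_assoc, ← Matrix.mul_assoc U, hU, Matrix.one_mul]
    have hid : 1 - (1 - R * U) = R * U := sub_sub_cancel _ _
    refine ⟨LinearMap.range (1 - R * U).mulVecLin, 1 - R * U, ?_, ⟨?_, ?_, rfl⟩, ?_⟩
    · rintro _ ⟨x, rfl⟩
      refine ⟨Aᵀ *ᵥ ((1 - R * U) *ᵥ x), ?_⟩
      have h1 : R * U * (Aᵀ * (1 - R * U)) = 0 := by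
        have h2 : Rᵀ * (1 - R * U) = 0 := by
          have : (1 - R * U) * R = 0 := by
            rw [Matrix.sub_mul, Matrix.one_mul, Matrix.mul_assoc, hU, Matrix.mul_one, sub_self]
          have := congrArg transpose this
          rwa [Matrix.transpose_mul, Matrix.transpose_sub, hUs.eq, Matrix.transpose_one,
            Matrix.transpose_zero] at this
        calc R * U * (Aᵀ * (1 - R * U)) = Uᵀ * (A * R)ᵀ * (1 - R * U) := by
              rw [← hUs.eq]; simp [Matrix.transpose_mul, Matrix.mul_assoc]
          _ = Uᵀ * A'ᵀ * (Rᵀ * (1 - R * U)) := by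
              rw [hA]; simp only [Matrix.transpose_mul, Matrix.mul_assoc]
          _ = 0 := by rw [h2, Matrix.mul_zero]
      simp only [Matrix.mulVecLin_apply]
      rw [Matrix.mulVec_mulVec _ Aᵀ, Matrix.sub_mulVec, Matrix.one_mulVec,
        Matrix.mulVec_mulVec _ (R * U), h1, Matrix.zero_mulVec, sub_zero]
    · simp [Matrix.IsSymm, hUs.eq]
    · rw [Matrix.mul_sub, Matrix.mul_one, Matrix.sub_mul, Matrix.one_mul, hRR]; simp
    · rw [hid]
      refine isMoorePenrose_compression hUs rfl ?_ (hu _ R _ hR hA)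
      rw [Matrix.mul_assoc, hU, Matrix.mul_one]

lemma rank_eq_of_injective {n k : Type*} [Fintype n] [Fintype k] [DecidableEq k]
    {R : Matrix n k ℝ} (hR : Function.Injective R.mulVec) : R.rank = Fintype.card k := by
  rw [Matrix.rank, LinearMap.finrank_range_of_inj (f := R.mulVecLin) hR]
  simp

lemma rank_congruence {n k : ℕ} {R : Matrix (Fin n) (Fin k) ℝ}
    (hR : Function.Injective R.mulVec) {P : Matrix (Fin k) (Fin k) ℝ} (hP : IsUnit P) :
    (R * P * Rᵀ).rank = k := by
  obtain ⟨U, hU, -⟩ := exists_leftInverse_of_injective hR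
  apply le_antisymm
  · rw [Matrix.mul_assoc]
    exact (Matrix.rank_mul_le_left _ _).trans (by simpa using Matrix.rank_le_width R)
  · have e : P = U * (R * P * Rᵀ * Uᵀ) := by
      have h : Rᵀ * Uᵀ = 1 := by rw [← Matrix.transpose_mul, hU, Matrix.transpose_one]
      rw [Matrix.mul_assoc, h, Matrix.mul_one, ← Matrix.mul_assoc, hU, Matrix.one_mul]
    have h1 := Matrix.rank_of_isUnit P hP
    rw [e] at h1
    have h2 := (Matrix.rank_mul_le_right U (R * P * Rᵀ * Uᵀ)).trans (Matrix.rank_mul_le_left _ _)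
    rw [h1] at h2
    simpa using h2

end Compression

/-! ### Completion of an observable pair to a lossless system -/

section Completion

variable {n m : Type*} [Fintype n] [DecidableEq n] [Fintype m] [DecidableEq m]

/-- Completion of an observable pair to an all-pass system: a nonsingular solution of the Stein
equation is the dual Gramian of the all-pass function normalized to `I` at `z = 1`, namely
`I + (z - 1) C (zI - A)⁻¹ K⁻¹ (I - Aᵀ)⁻¹ Cᵀ`. -/
lemma exists_lossless_completion {A K : Matrix n n ℝ} {C : Matrix m n ℝ} (hK : K.IsSymm)
    (hu : IsUnit K.det) (hA : IsUnit (A - 1).det) (h : Aᵀ * K * A - K = Cᵀ * C) :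
    ∃ (G : Matrix n m ℝ) (L : Matrix m m ℝ), Lossless A G C L K⁻¹ := by
  have hE : IsUnit (1 - A).det := by
    rw [← neg_sub, Matrix.det_neg]
    exact ((isUnit_one.neg).pow _).mul hA
  set P := K⁻¹ with hP
  have hPs : Pᵀ = P := hK.inv.eq
  set E := 1 - A with hEdef
  set Z := E⁻¹ with hZ
  have hEZ : E * Z = 1 := Matrix.mul_nonsing_inv _ hE
  have hZE : Z * E = 1 := Matrix.nonsing_inv_mul _ hE
  have hEZt : Zᵀ * Eᵀ = 1 := by rw [← Matrix.transpose_mul, hEZ, Matrix.transpose_one]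
  have hZEt : Eᵀ * Zᵀ = 1 := by rw [← Matrix.transpose_mul, hZE, Matrix.transpose_one]
  have hAE : A = 1 - E := by rw [hEdef]; abel
  have hKP : K * P = 1 := Matrix.mul_nonsing_inv _ hu
  have hPK : P * K = 1 := Matrix.nonsing_inv_mul _ hu
  -- the Stein equation after the Cayley transform
  have hW : Zᵀ * Cᵀ * C * Z = K - K * Z - Zᵀ * K := by
    calc Zᵀ * Cᵀ * C * Z = Zᵀ * (Eᵀ * K * E - Eᵀ * K - K * E) * Z := by
          rw [Matrix.mul_assoc Zᵀ, ← h, hAE]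
          simp only [Matrix.transpose_sub, Matrix.transpose_one, Matrix.mul_sub, Matrix.sub_mul,
            Matrix.one_mul, Matrix.mul_one]
          abel
      _ = (Zᵀ * Eᵀ) * K * (E * Z) - (Zᵀ * Eᵀ) * K * Z - Zᵀ * K * (E * Z) := by
          simp only [Matrix.mul_sub, Matrix.sub_mul, Matrix.mul_assoc]
      _ = _ := by rw [hEZ, hEZt, Matrix.one_mul, Matrix.mul_one, Matrix.mul_one]
  have hPWP : P * Zᵀ * Cᵀ * (C * Z * P) = P - Z * P - P * Zᵀ := by
    calc P * Zᵀ * Cᵀ * (C * Z * P) = P * (Zᵀ * Cᵀ * C * Z) * P := by simp only [Matrix.mul_assoc]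
      _ = P * K * P - P * K * Z * P - P * Zᵀ * (K * P) := by
        rw [hW]; simp only [Matrix.mul_sub, Matrix.sub_mul, Matrix.mul_assoc]
      _ = _ := by rw [hKP, hPK, Matrix.one_mul, Matrix.one_mul, Matrix.mul_one]
  refine ⟨-(E * (P * Zᵀ * Cᵀ)), 1 + C * (P * Zᵀ * Cᵀ), hK.inv, ?_, ?_, ?_⟩
  · have e : (-(E * (P * Zᵀ * Cᵀ))) * (-(E * (P * Zᵀ * Cᵀ)))ᵀ =
        E * (P * Zᵀ * Cᵀ * (C * Z * P)) * Eᵀ := by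
      simp [Matrix.transpose_mul, hPs, Matrix.mul_assoc]
    have e2 : E * (P - Z * P - P * Zᵀ) * Eᵀ =
        E * P * Eᵀ - (E * Z) * P * Eᵀ - E * P * (Zᵀ * Eᵀ) := by
      simp only [Matrix.mul_sub, Matrix.sub_mul, Matrix.mul_assoc]
    rw [e, hPWP, e2, hEZ, hEZt, hAE]
    simp only [Matrix.transpose_sub, Matrix.transpose_one, Matrix.mul_sub, Matrix.sub_mul,
      Matrix.one_mul, Matrix.mul_one]
    abel
  · have e : (-(E * (P * Zᵀ * Cᵀ))) * (1 + C * (P * Zᵀ * Cᵀ))ᵀ =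
        -(E * (P * Zᵀ * Cᵀ)) - E * (P * Zᵀ * Cᵀ * (C * Z * P)) * Cᵀ := by
      simp [Matrix.transpose_mul, Matrix.mul_add, hPs, Matrix.mul_assoc, sub_eq_add_neg]
    have e2 : E * (P - Z * P - P * Zᵀ) * Cᵀ =
        E * P * Cᵀ - (E * Z) * P * Cᵀ - E * (P * Zᵀ * Cᵀ) := by
      simp only [Matrix.mul_sub, Matrix.sub_mul, Matrix.mul_assoc]
    rw [e, hPWP, e2, hEZ, hAE]
    simp only [Matrix.sub_mul, Matrix.one_mul]
    abel
  · have e : (1 + C * (P * Zᵀ * Cᵀ)) * (1 + C * (P * Zᵀ * Cᵀ))ᵀ =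
        1 + C * (P * Zᵀ * Cᵀ) + C * Z * P * Cᵀ + C * (P * Zᵀ * Cᵀ * (C * Z * P)) * Cᵀ := by
      simp only [Matrix.transpose_add, Matrix.transpose_one, Matrix.transpose_mul, hPs,
        Matrix.transpose_transpose, Matrix.mul_add, Matrix.add_mul, Matrix.one_mul, Matrix.mul_one,
        Matrix.mul_assoc]
      abel
    rw [e, hPWP]
    simp only [Matrix.mul_sub, Matrix.sub_mul, Matrix.mul_assoc]
    abel

end Completion

/-! ### Stein equations with unmixed state matrix -/

section Unmixed

open Polynomial

lemma aeval_intertwine {n k : Type*} [Fintype n] [DecidableEq n] [Fintype k] [DecidableEq k]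
    {A : Matrix n n ℝ} {A' : Matrix k k ℝ} {R : Matrix n k ℝ} (hA : A * R = R * A') (p : ℝ[X]) :
    aeval A p * R = R * aeval A' p := by
  induction p using Polynomial.induction_on' with
  | add p q hp hq => simp only [map_add, Matrix.add_mul, Matrix.mul_add, hp, hq]
  | monomial i a =>
    rw [aeval_monomial, aeval_monomial, ← Algebra.smul_def, ← Algebra.smul_def, Matrix.smul_mul,
      Matrix.mul_smul, pow_intertwine hA]

/-- Iterating `Aᵀ Δ A = Δ` against the coefficients of a polynomial reverses the polynomial. -/
lemma aeval_reflect_mul {k : Type*} [Fintype k] [DecidableEq k] {A Δ : Matrix k k ℝ}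
    (h : Aᵀ * Δ * A = Δ) (N : ℕ) (p : ℝ[X]) (hp : p.natDegree ≤ N) :
    aeval Aᵀ (reflect N p) * Δ = Aᵀ ^ N * Δ * aeval A p := by
  have hpow : ∀ i : ℕ, Aᵀ ^ i * Δ * A ^ i = Δ := by
    intro i
    induction i with
    | zero => simp
    | succ i ih =>
      calc Aᵀ ^ (i + 1) * Δ * A ^ (i + 1) = Aᵀ ^ i * (Aᵀ * Δ * A) * A ^ i := by
            rw [pow_succ, pow_succ']; simp only [Matrix.mul_assoc]
        _ = Δ := by rw [h, ih]
  refine Polynomial.induction_with_natDegree_le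
    (fun p => aeval Aᵀ (reflect N p) * Δ = Aᵀ ^ N * Δ * aeval A p) N ?_ ?_ ?_ p hp
  · simp
  · intro i r _ hi
    rw [reflect_C_mul_X_pow, revAt_le hi]
    simp only [map_mul, aeval_C, map_pow, aeval_X, ← Algebra.smul_def, Matrix.smul_mul,
      Matrix.mul_smul]
    congr 1
    conv_lhs => rw [← hpow i]
    rw [← Matrix.mul_assoc, ← Matrix.mul_assoc, ← pow_add, Nat.sub_add_cancel hi]
  · intro f g _ _ hf hg
    rw [reflect_add, map_add, map_add, Matrix.add_mul, Matrix.mul_add, hf, hg]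

/-- For unmixed `A` the characteristic polynomial is coprime to its reverse. -/
lemma Unmixed.isCoprime {n : ℕ} {A : Matrix (Fin n) (Fin n) ℝ} (h : Unmixed A) :
    IsCoprime A.charpoly A.charpoly.reverse := by
  rw [Polynomial.isCoprime_iff_aeval_ne_zero_of_isAlgClosed ℝ ℂ]
  intro a
  by_contra! hc
  obtain ⟨h1, h2⟩ := hc
  have hspec : ∀ b : ℂ, aeval b A.charpoly = 0 → b ∈ spectrum ℂ (A.map Complex.ofReal) := by
    intro b hb
    rw [Matrix.mem_spectrum_iff_isRoot_charpoly]
    have : (A.map Complex.ofReal).charpoly = A.charpoly.map Complex.ofRealHom :=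
      Matrix.charpoly_map A Complex.ofRealHom
    rw [this, Polynomial.IsRoot, Polynomial.eval_map]
    exact hb
  have ha : a ≠ 0 := by
    rintro rfl
    rw [← Polynomial.coeff_zero_eq_aeval_zero', Polynomial.coeff_zero_reverse,
      A.charpoly_monic.leadingCoeff] at h2
    simp at h2
  refine h a (hspec a h1) a⁻¹ (hspec a⁻¹ ?_) (mul_inv_cancel₀ ha)
  let : Invertible a⁻¹ := invertibleOfNonzero (inv_ne_zero ha)
  have h3 := Polynomial.eval₂_reverse_mul_pow (algebraMap ℝ ℂ) a⁻¹ A.charpoly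
  have h4 : ⅟(a⁻¹) = a := by rw [invOf_eq_inv, inv_inv]
  rw [h4] at h3
  rw [Polynomial.aeval_def] at h2 ⊢
  rw [← h3, h2, zero_mul]

/-- Uniqueness for the Stein equation on an invariant subspace of an unmixed matrix. -/
lemma Unmixed.eq_zero_of_stein {n k : ℕ} {A : Matrix (Fin n) (Fin n) ℝ} (h : Unmixed A)
    {A' Δ : Matrix (Fin k) (Fin k) ℝ} {R : Matrix (Fin n) (Fin k) ℝ}
    (hR : Function.Injective R.mulVec) (hA : A * R = R * A') (hΔ : A'ᵀ * Δ * A' = Δ) : Δ = 0 := by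
  obtain ⟨U, hU, -⟩ := exists_leftInverse_of_injective hR
  have hU' : Rᵀ * Uᵀ = 1 := by rw [← Matrix.transpose_mul, hU, Matrix.transpose_one]
  have hp : aeval A' A.charpoly = 0 := by
    have := aeval_intertwine hA A.charpoly
    rw [Matrix.aeval_self_charpoly, Matrix.zero_mul] at this
    rw [← Matrix.one_mul (aeval A' A.charpoly), ← hU, Matrix.mul_assoc, ← this, Matrix.mul_zero]
  have hA' : A'ᵀ * Rᵀ = Rᵀ * Aᵀ := by rw [← Matrix.transpose_mul, ← hA, Matrix.transpose_mul]
  have hpt : aeval A'ᵀ A.charpoly = 0 := by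
    have := aeval_intertwine hA' A.charpoly
    rw [← Matrix.charpoly_transpose A, Matrix.aeval_self_charpoly, Matrix.mul_zero] at this
    rw [← Matrix.mul_one (aeval A'ᵀ A.charpoly), ← hU', ← Matrix.mul_assoc,
      ← Matrix.charpoly_transpose A, this, Matrix.zero_mul]
  have hq : aeval A'ᵀ A.charpoly.reverse * Δ = 0 := by
    rw [Polynomial.reverse, aeval_reflect_mul hΔ _ _ le_rfl, hp, Matrix.mul_zero]
  obtain ⟨u, v, huv⟩ := h.isCoprime
  have := congrArg (aeval A'ᵀ) huv
  rw [map_add, map_mul, map_mul, hpt, mul_zero, zero_add, map_one] at this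
  rw [← Matrix.one_mul Δ, ← this, Matrix.mul_assoc, hq, Matrix.mul_zero]

end Unmixed

/-! ### Left all-pass divisors -/

section Divisors

lemma isAllPass_iff_tf {m : ℕ} {k : Type*} [Fintype k] [DecidableEq k]
    {F : Matrix (Fin m) (Fin m) (RatFunc ℝ)} {A : Matrix k k ℝ} {B : Matrix k (Fin m) ℝ}
    {C : Matrix (Fin m) k ℝ} {D : Matrix (Fin m) (Fin m) ℝ}
    (hF : ∀ᶠ z in cofinite, evalAt F z = tf A B C D z) :
    IsAllPass F ↔ ∀ᶠ z in cofinite, tf A B C D z * (tf A B C D z⁻¹)ᵀ = 1 := by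
  rw [isAllPass_iff]
  apply eventually_congr
  filter_upwards [hF, tendsto_inv_cofinite.eventually hF] with z h1 h2
  rw [h1, h2]

variable {n m k : ℕ} {A : Matrix (Fin n) (Fin n) ℝ} {B : Matrix (Fin n) (Fin m) ℝ}
  {C : Matrix (Fin m) (Fin n) ℝ} {D : Matrix (Fin m) (Fin m) ℝ}

lemma isSolP_iff {P : Matrix (Fin n) (Fin n) ℝ} : IsSolP A B C D P ↔ Lossless A B C D P :=
  ⟨fun ⟨h1, h2, h3, h4⟩ => ⟨h1, h2, (sub_eq_zero.1 h3).symm, h4⟩,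
    fun h => ⟨h.symm, h.state, sub_eq_zero.2 h.cross.symm, h.output⟩⟩

lemma observable_of_isMinimalRealization (hmin : IsMinimalRealization A B C D) :
    Observable A C :=
  observable_of_minimal (eventually_evalAt_transfer A B C D) (fun k hk => by simpa using hmin k hk)

lemma controllable_of_isMinimalRealization (hmin : IsMinimalRealization A B C D) :
    Observable Aᵀ Bᵀ :=
  controllable_of_minimal (eventually_evalAt_transfer A B C D) (fun k hk => by simpa using hmin k hk)

lemma IsMinimalRealization.mcMillanDegree_eq (hmin : IsMinimalRealization A B C D) :
    mcMillanDegree (transfer A B C D) = n :=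
  le_antisymm (mcMillanDegree_le ⟨A, B, C, D, rfl⟩)
    (hmin _ (hasRealization_mcMillanDegree ⟨n, A, B, C, D, rfl⟩))

/-- A minimal realization of an all-pass function has a nonsingular Gramian. -/
lemma exists_lossless_of_isAllPass (hmin : IsMinimalRealization A B C D)
    (hap : IsAllPass (transfer A B C D)) : ∃ P, Lossless A B C D P ∧ IsUnit P := by
  obtain ⟨P, hP⟩ := exists_lossless (observable_of_isMinimalRealization hmin)
    ((isAllPass_iff_tf (eventually_evalAt_transfer A B C D)).1 hap)
  exact ⟨P, hP, hP.isUnit (controllable_of_isMinimalRealization hmin)⟩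

lemma stein_restrict {Q : Matrix (Fin n) (Fin n) ℝ} (h : Aᵀ * Q * A - Q = Cᵀ * C)
    {R : Matrix (Fin n) (Fin k) ℝ} {A' : Matrix (Fin k) (Fin k) ℝ} (hA : A * R = R * A') :
    A'ᵀ * (Rᵀ * Q * R) * A' - Rᵀ * Q * R = (C * R)ᵀ * (C * R) := by
  have hA' : A'ᵀ * Rᵀ = Rᵀ * Aᵀ := by rw [← Matrix.transpose_mul, ← hA, Matrix.transpose_mul]
  calc A'ᵀ * (Rᵀ * Q * R) * A' - Rᵀ * Q * R
      = (A'ᵀ * Rᵀ) * Q * (R * A') - Rᵀ * Q * R := by simp only [Matrix.mul_assoc]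
    _ = Rᵀ * (Aᵀ * Q * A - Q) * R := by
      rw [hA', ← hA]; simp only [Matrix.mul_sub, Matrix.sub_mul, Matrix.mul_assoc]
    _ = _ := by rw [h, Matrix.transpose_mul]; simp only [Matrix.mul_assoc]

lemma isSymm_restrict {Q : Matrix (Fin n) (Fin n) ℝ} (hQ : Q.IsSymm)
    (R : Matrix (Fin n) (Fin k) ℝ) : (Rᵀ * Q * R).IsSymm := by
  simp [Matrix.IsSymm, Matrix.transpose_mul, hQ.eq, Matrix.mul_assoc]

/-- The dual Gramian is nondegenerate on every invariant subspace. -/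
lemma isUnit_det_restrict {Q : Matrix (Fin n) (Fin n) ℝ} (hobs : Observable A C) (hQ : Q.IsSymm)
    (h : Aᵀ * Q * A - Q = Cᵀ * C) {R : Matrix (Fin n) (Fin k) ℝ} {A' : Matrix (Fin k) (Fin k) ℝ}
    (hR : Function.Injective R.mulVec) (hA : A * R = R * A') : IsUnit (Rᵀ * Q * R).det := by
  rw [← Matrix.isUnit_iff_isUnit_det]
  exact isUnit_of_stein (isSymm_restrict hQ R) (stein_restrict h hA) (hobs.restrict hR hA)

lemma gram_fromCols (G : Matrix (Fin n) (Fin m) ℝ) (L : Matrix (Fin m) (Fin m) ℝ) :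
    (fromCols Gᵀ Lᵀ)ᵀ * fromCols Gᵀ Lᵀ = fromBlocks (G * Gᵀ) (G * Lᵀ) (L * Gᵀ) (L * Lᵀ) := by
  rw [transpose_fromCols, Matrix.transpose_transpose, Matrix.transpose_transpose,
    fromRows_mul_fromCols]

/-- A lossless system on an invariant subspace gives a factorization of `M(P)`. -/
lemma lmiM_of_lossless {R : Matrix (Fin n) (Fin k) ℝ} {A' P' : Matrix (Fin k) (Fin k) ℝ}
    (hA : A * R = R * A') {G : Matrix (Fin k) (Fin m) ℝ} {L : Matrix (Fin m) (Fin m) ℝ}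
    (h : Lossless A' G (C * R) L P') :
    lmiM A C (R * P' * Rᵀ) = (fromCols (R * G)ᵀ Lᵀ)ᵀ * fromCols (R * G)ᵀ Lᵀ := by
  have hA' : Rᵀ * Aᵀ = A'ᵀ * Rᵀ := by rw [← Matrix.transpose_mul, hA, Matrix.transpose_mul]
  have hC' : Rᵀ * Cᵀ = (C * R)ᵀ := by rw [Matrix.transpose_mul]
  rw [gram_fromCols, lmiM]
  congr 1
  · calc A * (R * P' * Rᵀ) * Aᵀ - R * P' * Rᵀ
        = (A * R) * P' * (Rᵀ * Aᵀ) - R * P' * Rᵀ := by simp only [Matrix.mul_assoc]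
      _ = R * (A' * P' * A'ᵀ - P') * Rᵀ := by
        rw [hA, hA']; simp only [Matrix.mul_sub, Matrix.sub_mul, Matrix.mul_assoc]
      _ = _ := by rw [h.state, Matrix.transpose_mul]; simp only [Matrix.mul_assoc]
  · calc A * (R * P' * Rᵀ) * Cᵀ = (A * R) * P' * (Rᵀ * Cᵀ) := by simp only [Matrix.mul_assoc]
      _ = R * (A' * P' * (C * R)ᵀ) := by rw [hA, hC']; simp only [Matrix.mul_assoc]
      _ = _ := by rw [h.cross, Matrix.mul_assoc]
  · calc C * (R * P' * Rᵀ) * Aᵀ = (C * R) * P' * (Rᵀ * Aᵀ) := by simp only [Matrix.mul_assoc]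
      _ = (C * R * P' * A'ᵀ) * Rᵀ := by rw [hA']; simp only [Matrix.mul_assoc]
      _ = _ := by rw [h.cross', Matrix.transpose_mul, Matrix.mul_assoc]
  · have : C * (R * P' * Rᵀ) * Cᵀ = C * R * P' * (C * R)ᵀ := by
      rw [← hC']; simp only [Matrix.mul_assoc]
    rw [this, ← h.output]; abel

/-- The full row rank condition is automatic for lossless systems: a vector `x` with `R G x = 0` and
`L x = 0` is killed by the dual output equation `Lᵀ L - Gᵀ P'⁻¹ G = I`. -/
lemma rank_fromCols_of_lossless {R : Matrix (Fin n) (Fin k) ℝ} {A' P' : Matrix (Fin k) (Fin k) ℝ}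
    {C' : Matrix (Fin m) (Fin k) ℝ} (hR : Function.Injective R.mulVec) (hP : IsUnit P')
    {G : Matrix (Fin k) (Fin m) ℝ} {L : Matrix (Fin m) (Fin m) ℝ} (h : Lossless A' G C' L P') :
    (fromCols (R * G)ᵀ Lᵀ).rank = m := by
  have ho := (h.inv hP).output
  simp only [Matrix.transpose_transpose] at ho
  rw [← Matrix.rank_transpose, transpose_fromCols, Matrix.transpose_transpose,
    Matrix.transpose_transpose, rank_eq_of_injective, Fintype.card_fin]
  have hinj : Function.Injective (fromRows (R * G) L).mulVecLin := by
    rw [injective_iff_map_eq_zero]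
    intro x hx
    have hx : fromRows (R * G) L *ᵥ x = 0 := hx
    rw [fromRows_mulVec] at hx
    have hL : L *ᵥ x = 0 := funext fun i => congrFun hx (Sum.inr i)
    have hRG : R *ᵥ (G *ᵥ x) = 0 := by
      rw [Matrix.mulVec_mulVec]; exact funext fun i => congrFun hx (Sum.inl i)
    have hG : G *ᵥ x = 0 := hR (by simpa using hRG)
    have := congrArg (fun M => M *ᵥ x) ho
    simpa [Matrix.sub_mulVec, ← Matrix.mulVec_mulVec, hL, hG] using this.symm
  exact hinj

/-- Every factorization of `M(R P' Rᵀ)` comes from a lossless system on the invariant subspace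
spanned by the columns of `R`. -/
lemma exists_lossless_of_lmiM {R : Matrix (Fin n) (Fin k) ℝ} {A' P' : Matrix (Fin k) (Fin k) ℝ}
    (hR : Function.Injective R.mulVec) (hA : A * R = R * A') (hP' : P'.IsSymm)
    {G : Matrix (Fin n) (Fin m) ℝ} {L : Matrix (Fin m) (Fin m) ℝ}
    (h : lmiM A C (R * P' * Rᵀ) = (fromCols Gᵀ Lᵀ)ᵀ * fromCols Gᵀ Lᵀ) :
    ∃ G' : Matrix (Fin k) (Fin m) ℝ, G = R * G' ∧ Lossless A' G' (C * R) L P' := by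
  obtain ⟨U, hU, -⟩ := exists_leftInverse_of_injective hR
  have hUt : Rᵀ * Uᵀ = 1 := by rw [← Matrix.transpose_mul, hU, Matrix.transpose_one]
  have hA' : Rᵀ * Aᵀ = A'ᵀ * Rᵀ := by rw [← Matrix.transpose_mul, hA, Matrix.transpose_mul]
  have hC' : Rᵀ * Cᵀ = (C * R)ᵀ := by rw [Matrix.transpose_mul]
  rw [gram_fromCols, lmiM] at h
  obtain ⟨h1, h2, -, h4⟩ := fromBlocks_inj.1 h
  have h1' : R * (A' * P' * A'ᵀ - P') * Rᵀ = G * Gᵀ := by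
    rw [← h1]
    calc R * (A' * P' * A'ᵀ - P') * Rᵀ = (R * A') * P' * (A'ᵀ * Rᵀ) - R * P' * Rᵀ := by
          simp only [Matrix.mul_sub, Matrix.sub_mul, Matrix.mul_assoc]
      _ = _ := by rw [← hA, ← hA']; simp only [Matrix.mul_assoc]
  -- `G Gᵀ` lives on the column space of `R`, so the columns of `G` do too
  have hG : (1 - R * U) * G = 0 := by
    rw [← Matrix.self_mul_conjTranspose_eq_zero, Matrix.conjTranspose_eq_transpose_of_trivial,
      Matrix.transpose_mul, Matrix.mul_assoc, ← Matrix.mul_assoc G, ← h1']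
    have : (1 - R * U) * R = 0 := by
      rw [Matrix.sub_mul, Matrix.one_mul, Matrix.mul_assoc, hU, Matrix.mul_one, sub_self]
    simp only [← Matrix.mul_assoc, this, Matrix.zero_mul]
  have hG' : G = R * (U * G) := by
    rw [Matrix.sub_mul, Matrix.one_mul, sub_eq_zero] at hG
    rw [← Matrix.mul_assoc]; exact hG
  refine ⟨U * G, hG', hP', ?_, ?_, ?_⟩
  · calc A' * P' * A'ᵀ - P' = (U * R) * (A' * P' * A'ᵀ - P') * (Rᵀ * Uᵀ) := by
          rw [hU, hUt, Matrix.one_mul, Matrix.mul_one]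
      _ = U * (R * (A' * P' * A'ᵀ - P') * Rᵀ) * Uᵀ := by simp only [Matrix.mul_assoc]
      _ = _ := by rw [h1', Matrix.transpose_mul]; simp only [Matrix.mul_assoc]
  · calc A' * P' * (C * R)ᵀ = (U * R) * A' * P' * (Rᵀ * Cᵀ) := by
          rw [hU, hC', Matrix.one_mul]
      _ = U * (A * (R * P' * Rᵀ) * Cᵀ) := by
          rw [Matrix.mul_assoc U R, ← hA]; simp only [Matrix.mul_assoc]
      _ = _ := by rw [h2, Matrix.mul_assoc]
  · have : C * R * P' * (C * R)ᵀ = C * (R * P' * Rᵀ) * Cᵀ := by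
      rw [← hC']; simp only [Matrix.mul_assoc]
    rw [this, ← h4]; abel

/-- A lossless system on an invariant subspace of dimension `k` is a left all-pass divisor of
McMillan degree `k`. The cofactor `F₁(z⁻¹)ᵀ F(z)` has a realization on the state matrix `A` whose
output vanishes on the invariant subspace, hence one of dimension `n - k`. -/
lemma isLeftAllPassDivisor_of_lossless {Q : Matrix (Fin n) (Fin n) ℝ}
    (hmin : IsMinimalRealization A B C D) (hQ : Lossless Aᵀ Cᵀ Bᵀ Dᵀ Q)
    {R : Matrix (Fin n) (Fin k) ℝ} {A' : Matrix (Fin k) (Fin k) ℝ}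
    (hR : Function.Injective R.mulVec) (hA : A * R = R * A')
    (hu : IsUnit (Rᵀ * Q * R).det) {G : Matrix (Fin k) (Fin m) ℝ} {L : Matrix (Fin m) (Fin m) ℝ}
    (h : Lossless A' G (C * R) L (Rᵀ * Q * R)⁻¹) :
    IsLeftAllPassDivisor (transfer A (R * G) C L) (transfer A B C D) ∧
      mcMillanDegree (transfer A (R * G) C L) = k := by
  have hu' : IsUnit (Rᵀ * Q * R)⁻¹ := by
    rw [Matrix.isUnit_iff_isUnit_det]; exact Matrix.isUnit_nonsing_inv_det _ hu
  have hd := h.inv hu'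
  rw [Matrix.nonsing_inv_nonsing_inv _ hu] at hd
  have hF := eventually_evalAt_transfer A B C D
  have hF₁ := eventually_evalAt_transfer A (R * G) C L
  have hF₁' : ∀ᶠ z in cofinite,
      evalAt (transfer A (R * G) C L) z = tf A' G (C * R) L z := by
    filter_upwards [hF₁, tf_intertwine hA.symm G C L] with z h1 h2
    rw [h1, h2]
  set H := Lᵀ * C - (R * G)ᵀ * Q * A with hH
  set J := Lᵀ * D - (R * G)ᵀ * Q * B with hJ
  have hF₂ := eventually_evalAt_transfer A B H J
  have hprod := hQ.tf_inv_transpose_mul_tf (R * G) L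
  have hap := hQ.tf_mul_tf_inv_transpose
  have hap₁ : ∀ᶠ z in cofinite, tf A (R * G) C L z * (tf A (R * G) C L z⁻¹)ᵀ = 1 :=
    (isAllPass_iff_tf hF₁).1 ((isAllPass_iff_tf hF₁').2 hd.tf_mul_tf_inv_transpose)
  have hap₂ : ∀ᶠ z in cofinite, tf A B H J z * (tf A B H J z⁻¹)ᵀ = 1 := by
    filter_upwards [hprod, tendsto_inv_cofinite.eventually hprod, hap, hap₁] with z h1 h2 h3 h4
    rw [inv_inv] at h2
    rw [← h1, ← h2, Matrix.transpose_mul, Matrix.transpose_transpose, Matrix.mul_assoc,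
      ← Matrix.mul_assoc (tf A B C D z), h3, Matrix.one_mul, mul_eq_one_comm, h4]
  have hfac : transfer A B C D = transfer A (R * G) C L * transfer A B H J := by
    apply eq_of_eventually_evalAt
    filter_upwards [hF, hF₁, hF₂, hprod, hap₁,
      eventually_evalAt_mul (transfer A (R * G) C L) (transfer A B H J)] with z h1 h2 h3 h4 h5 h6
    rw [h6, h1, h2, h3, ← h4, ← Matrix.mul_assoc, h5, Matrix.one_mul]
  have hHR : H * R = 0 := by
    have h1 := hd.cross'
    simp only [Matrix.transpose_transpose] at h1
    calc H * R = Lᵀ * (C * R) - Gᵀ * Rᵀ * Q * (A * R) := by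
          rw [hH, Matrix.sub_mul, Matrix.transpose_mul]; simp only [Matrix.mul_assoc]
      _ = Lᵀ * (C * R) - Gᵀ * (Rᵀ * Q * R) * A' := by rw [hA]; simp only [Matrix.mul_assoc]
      _ = 0 := by rw [h1, sub_self]
  have hk : k ≤ n := by
    have := LinearMap.finrank_le_finrank_of_injective (f := R.mulVecLin) hR
    simpa using this
  have r₁ : HasRealization (transfer A (R * G) C L) k := by
    simpa using hasRealization_of_tf hF₁'
  have r₂ : HasRealization (transfer A B H J) (n - k) := by
    simpa using hasRealization_sub hF₂ hR hA hHR
  have d₁ := mcMillanDegree_le r₁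
  have d₂ := mcMillanDegree_le r₂
  have d := hmin _ (hfac ▸ (hasRealization_mcMillanDegree ⟨k, r₁⟩).mul
    (hasRealization_mcMillanDegree ⟨n - k, r₂⟩))
  refine ⟨⟨transfer A B H J, hfac, ⟨k, r₁⟩, ⟨n - k, r₂⟩, (isAllPass_iff_tf hF₁).2 hap₁,
    (isAllPass_iff_tf hF₂).2 hap₂, ?_⟩, by omega⟩
  rw [hmin.mcMillanDegree_eq]
  omega

/-- The block-diagonal dual Gramian of a cascade. -/
lemma Lossless.cascade {k₁ k₂ : Type} [Fintype k₁] [DecidableEq k₁] [Fintype k₂] [DecidableEq k₂]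
    {A₁ Q₁ : Matrix k₁ k₁ ℝ} {B₁ : Matrix k₁ (Fin m) ℝ} {C₁ : Matrix (Fin m) k₁ ℝ}
    {D₁ : Matrix (Fin m) (Fin m) ℝ} {A₂ Q₂ : Matrix k₂ k₂ ℝ} {B₂ : Matrix k₂ (Fin m) ℝ}
    {C₂ : Matrix (Fin m) k₂ ℝ} {D₂ : Matrix (Fin m) (Fin m) ℝ}
    (h₁ : Lossless A₁ᵀ C₁ᵀ B₁ᵀ D₁ᵀ Q₁) (h₂ : Lossless A₂ᵀ C₂ᵀ B₂ᵀ D₂ᵀ Q₂) :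
    Lossless (fromBlocks A₁ (B₁ * C₂) 0 A₂)ᵀ (fromCols C₁ (D₁ * C₂))ᵀ
      (fromRows (B₁ * D₂) B₂)ᵀ (D₁ * D₂)ᵀ (fromBlocks Q₁ 0 0 Q₂) := by
  obtain ⟨s₁, a₁, c₁, o₁⟩ := h₁
  obtain ⟨s₂, a₂, c₂, o₂⟩ := h₂
  have c₁' := congrArg transpose c₁
  simp only [Matrix.transpose_transpose] at a₁ c₁ o₁ a₂ c₂ o₂ c₁'
  simp only [Matrix.transpose_mul, Matrix.transpose_transpose, s₁.eq, ← Matrix.mul_assoc] at c₁'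
  have b₁ : B₁ᵀ * Q₁ * B₁ = D₁ᵀ * D₁ - 1 := by rw [← o₁]; abel
  have key : ∀ {p q : Type} (M : Matrix (Fin m) p ℝ) (N : Matrix (Fin m) q ℝ),
      Mᵀ * B₁ᵀ * Q₁ * (B₁ * N) = Mᵀ * D₁ᵀ * (D₁ * N) - Mᵀ * N := by
    intro p q M N
    calc Mᵀ * B₁ᵀ * Q₁ * (B₁ * N) = Mᵀ * (B₁ᵀ * Q₁ * B₁) * N := by simp only [Matrix.mul_assoc]
      _ = _ := by
        rw [b₁, Matrix.mul_sub, Matrix.sub_mul, Matrix.mul_one]; simp only [Matrix.mul_assoc]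
  refine ⟨s₁.fromBlocks (by simp) s₂, ?_, ?_, ?_⟩
  · simp only [fromBlocks_transpose, transpose_fromCols, transpose_fromRows,
      Matrix.transpose_transpose, fromBlocks_multiply, fromRows_mul_fromCols, Matrix.transpose_zero, Matrix.mul_zero,
      Matrix.zero_mul, add_zero, zero_add, Matrix.transpose_mul, key]
    rw [sub_eq_add_neg, fromBlocks_neg, fromBlocks_add, fromBlocks_inj]
    refine ⟨by rw [← sub_eq_add_neg, a₁], ?_, ?_, ?_⟩
    · rw [neg_zero, add_zero, ← Matrix.mul_assoc, c₁, Matrix.mul_assoc]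
    · rw [neg_zero, add_zero, Matrix.mul_assoc C₂ᵀ, Matrix.mul_assoc C₂ᵀ, c₁', Matrix.mul_assoc]
    · rw [← sub_eq_zero] at a₂
      rw [← sub_eq_zero, ← a₂]
      abel
  · simp only [fromBlocks_transpose, transpose_fromCols, transpose_fromRows,
      Matrix.transpose_transpose, fromBlocks_multiply, fromBlocks_mul_fromRows, fromRows_mul,
      Matrix.transpose_zero, Matrix.mul_zero,
      Matrix.zero_mul, add_zero, zero_add, Matrix.transpose_mul, key]
    congr 1
    · rw [← Matrix.mul_assoc, c₁, Matrix.mul_assoc]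
    · rw [c₂]; simp only [Matrix.mul_assoc]; abel
  · simp only [transpose_fromRows, Matrix.transpose_transpose, transpose_fromCols,
      fromCols_mul_fromBlocks,
      fromCols_mul_fromRows, Matrix.mul_zero, add_zero, zero_add, Matrix.transpose_mul, key]
    rw [← o₂]; simp only [Matrix.mul_assoc]; abel

/-- Every left all-pass divisor is carried by an invariant subspace: the cascade of minimal
realizations of the two factors is minimal, hence isomorphic to the given realization, and its
dual Gramian is block diagonal. -/
lemma exists_invariant_of_isLeftAllPassDivisor {Q : Matrix (Fin n) (Fin n) ℝ}
    (hmin : IsMinimalRealization A B C D) (hQ : Lossless Aᵀ Cᵀ Bᵀ Dᵀ Q)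
    {F : Matrix (Fin m) (Fin m) (RatFunc ℝ)}
    (hF : IsLeftAllPassDivisor F (transfer A B C D)) :
    ∃ (k : ℕ) (R : Matrix (Fin n) (Fin k) ℝ) (A' : Matrix (Fin k) (Fin k) ℝ)
      (G : Matrix (Fin k) (Fin m) ℝ) (L : Matrix (Fin m) (Fin m) ℝ),
      Function.Injective R.mulVec ∧ A * R = R * A' ∧
        Lossless A' G (C * R) L (Rᵀ * Q * R)⁻¹ ∧ F = transfer A (R * G) C L := by
  obtain ⟨F₂, hfac, hr₁, hr₂, hap₁, hap₂, hdeg⟩ := hF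
  rw [hmin.mcMillanDegree_eq] at hdeg
  obtain ⟨A₁, B₁, C₁, D₁, hF₁⟩ := hasRealization_mcMillanDegree hr₁
  obtain ⟨A₂, B₂, C₂, D₂, hF₂⟩ := hasRealization_mcMillanDegree hr₂
  have hmin₁ : IsMinimalRealization A₁ B₁ C₁ D₁ := fun k hk => mcMillanDegree_le (hF₁ ▸ hk)
  have hmin₂ : IsMinimalRealization A₂ B₂ C₂ D₂ := fun k hk => mcMillanDegree_le (hF₂ ▸ hk)
  generalize mcMillanDegree F = n₁ at *
  generalize mcMillanDegree F₂ = n₂ at *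
  subst hF₁ hF₂
  obtain ⟨P₁, hP₁, hu₁⟩ := exists_lossless_of_isAllPass hmin₁ hap₁
  obtain ⟨P₂, hP₂, hu₂⟩ := exists_lossless_of_isAllPass hmin₂ hap₂
  set Ac := fromBlocks A₁ (B₁ * C₂) 0 A₂ with hAc
  set Bc := fromRows (B₁ * D₂) B₂ with hBc
  set Cc := fromCols C₁ (D₁ * C₂) with hCc
  have hc : ∀ᶠ z in cofinite, evalAt (transfer A B C D) z = tf Ac Bc Cc (D₁ * D₂) z := by
    filter_upwards [eventually_evalAt_mul (transfer A₁ B₁ C₁ D₁) (transfer A₂ B₂ C₂ D₂),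
      eventually_evalAt_transfer A₁ B₁ C₁ D₁, eventually_evalAt_transfer A₂ B₂ C₂ D₂,
      tf_cascade A₁ B₁ C₁ D₁ A₂ B₂ C₂ D₂] with z h1 h2 h3 h4
    rw [hfac, h1, h2, h3, ← h4]
  have hcmin : ∀ k, HasRealization (transfer A B C D) k → Fintype.card (Fin n₁ ⊕ Fin n₂) ≤ k := by
    intro k hk
    have := hmin k hk
    simp only [Fintype.card_sum, Fintype.card_fin]
    omega
  obtain ⟨hDD, hmk⟩ := markov_eq (A := A) (B := B) (C := C) (D := D) (A₂ := Ac) (B₂ := Bc)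
    (C₂ := Cc) (D₂ := D₁ * D₂) (by
      filter_upwards [hc, eventually_evalAt_transfer A B C D] with z h1 h2
      rw [← h1, ← h2])
  obtain ⟨T, hTA, hTB, hTC⟩ := exists_state_map (observable_of_isMinimalRealization hmin)
    (controllable_of_minimal hc hcmin) hmk
  have hTinj : ∀ x, T *ᵥ x = 0 → x = 0 := by
    intro x hx
    apply observable_of_minimal hc hcmin
    intro i
    rw [← hTC, ← Matrix.mulVec_mulVec, Matrix.mulVec_mulVec _ T, ← pow_intertwine hTA,
      ← Matrix.mulVec_mulVec, hx, Matrix.mulVec_zero, Matrix.mulVec_zero]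
  -- transport of the dual Gramian to the cascade, where it is block diagonal by uniqueness
  have hTQ : Tᵀ * Q * T = fromBlocks P₁⁻¹ 0 0 P₂⁻¹ := by
    have hTA' : Tᵀ * Aᵀ = Acᵀ * Tᵀ := by rw [← Matrix.transpose_mul, hTA, Matrix.transpose_mul]
    refine Lossless.unique (controllable_of_minimal hc hcmin) ?_
      (Lossless.cascade (hP₁.inv hu₁) (hP₂.inv hu₂))
    obtain ⟨s, a, c, o⟩ := hQ
    change Lossless Acᵀ Ccᵀ Bcᵀ (D₁ * D₂)ᵀ _
    rw [← hDD]
    simp only [Matrix.transpose_transpose] at a c o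
    refine ⟨by simp [Matrix.IsSymm, Matrix.transpose_mul, s.eq, Matrix.mul_assoc], ?_, ?_, ?_⟩ <;>
      simp only [Matrix.transpose_transpose]
    · calc Acᵀ * (Tᵀ * Q * T) * Ac - Tᵀ * Q * T
          = (Acᵀ * Tᵀ) * Q * (T * Ac) - Tᵀ * Q * T := by simp only [Matrix.mul_assoc]
        _ = Tᵀ * (Aᵀ * Q * A - Q) * T := by
          rw [← hTA', ← hTA]; simp only [Matrix.mul_sub, Matrix.sub_mul, Matrix.mul_assoc]
        _ = _ := by rw [a, ← hTC, Matrix.transpose_mul]; simp only [Matrix.mul_assoc]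
    · calc Acᵀ * (Tᵀ * Q * T) * Bc = (Acᵀ * Tᵀ) * Q * (T * Bc) := by simp only [Matrix.mul_assoc]
        _ = Tᵀ * (Aᵀ * Q * B) := by rw [← hTA', hTB]; simp only [Matrix.mul_assoc]
        _ = _ := by rw [c, ← hTC, Matrix.transpose_mul, Matrix.mul_assoc]
    · rw [← o, ← hTB, Matrix.transpose_mul]; simp only [Matrix.mul_assoc]
  set I₁ : Matrix (Fin n₁ ⊕ Fin n₂) (Fin n₁) ℝ := fromRows 1 0 with hI₁
  have hAI : Ac * I₁ = I₁ * A₁ := by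
    rw [hI₁, hAc, fromBlocks_mul_fromRows, fromRows_mul]; simp
  have hRA : A * (T * I₁) = T * I₁ * A₁ := by
    rw [← Matrix.mul_assoc, hTA, Matrix.mul_assoc, hAI, Matrix.mul_assoc]
  have hRC : C * (T * I₁) = C₁ := by
    rw [← Matrix.mul_assoc, hTC, hCc, hI₁, fromCols_mul_fromRows]; simp
  have hRQ : (T * I₁)ᵀ * Q * (T * I₁) = P₁⁻¹ := by
    calc (T * I₁)ᵀ * Q * (T * I₁) = I₁ᵀ * (Tᵀ * Q * T) * I₁ := by
          rw [Matrix.transpose_mul]; simp only [Matrix.mul_assoc]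
      _ = P₁⁻¹ := by
          rw [hTQ, hI₁, transpose_fromRows, fromCols_mul_fromBlocks, fromCols_mul_fromRows]; simp
  have hRinj : Function.Injective (T * I₁).mulVecLin := by
    rw [injective_iff_map_eq_zero]
    intro x hx
    have hx : (T * I₁) *ᵥ x = 0 := hx
    rw [← Matrix.mulVec_mulVec] at hx
    have h0 := hTinj _ hx
    rw [hI₁, fromRows_mulVec] at h0
    ext i
    simpa using congrFun h0 (Sum.inl i)
  have hlos : Lossless A₁ B₁ (C * (T * I₁)) D₁ ((T * I₁)ᵀ * Q * (T * I₁))⁻¹ := by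
    rw [hRC, hRQ, Matrix.nonsing_inv_nonsing_inv _ ((Matrix.isUnit_iff_isUnit_det _).1 hu₁)]
    exact hP₁
  refine ⟨n₁, T * I₁, A₁, B₁, D₁, hRinj, hRA, hlos, ?_⟩
  apply eq_of_eventually_evalAt
  filter_upwards [eventually_evalAt_transfer A₁ B₁ C₁ D₁,
    eventually_evalAt_transfer A (T * I₁ * B₁) C D₁, tf_intertwine hRA.symm B₁ C D₁] with z h1 h2 h3
  rw [h1, h2, ← h3, hRC]

/-- Rank deficiency of `W P Wᵀ - diag(P, -I)` with `W = [A; C]` forces `P⁻¹` to solve the Stein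
equation: the kernel of that matrix must be the column space of `diag(P⁻¹, -I) W`. -/
lemma stein_of_rank_le {A P : Matrix (Fin k) (Fin k) ℝ} {C : Matrix (Fin m) (Fin k) ℝ}
    (hP : IsUnit P.det) (h : (lmiM A C P).rank ≤ m) : Aᵀ * P⁻¹ * A - P⁻¹ = Cᵀ * C := by
  set W := fromRows A C with hW
  set J := fromBlocks P⁻¹ 0 0 (-1 : Matrix (Fin m) (Fin m) ℝ) with hJ
  set J' := fromBlocks P 0 0 (-1 : Matrix (Fin m) (Fin m) ℝ) with hJ'
  have hJJ : J * J' = 1 := by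
    simp [hJ, hJ', fromBlocks_multiply, Matrix.nonsing_inv_mul _ hP]
  have hJJ' : J' * J = 1 := mul_eq_one_comm.1 hJJ
  have hM : lmiM A C P = W * P * Wᵀ - J' := by
    rw [lmiM, hW, hJ', transpose_fromRows, fromRows_mul, fromRows_mul_fromCols,
      sub_eq_add_neg (fromBlocks _ _ _ _), fromBlocks_neg, fromBlocks_add]
    simp [sub_eq_add_neg]
  have hker : LinearMap.ker (lmiM A C P).mulVecLin ≤ LinearMap.range (J * W).mulVecLin := by
    intro v hv
    have hv : lmiM A C P *ᵥ v = 0 := hv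
    rw [hM, Matrix.sub_mulVec, sub_eq_zero] at hv
    refine ⟨(P * Wᵀ) *ᵥ v, ?_⟩
    rw [Matrix.mulVecLin_apply, Matrix.mulVec_mulVec, Matrix.mul_assoc, ← Matrix.mul_assoc W,
      ← Matrix.mulVec_mulVec, hv, Matrix.mulVec_mulVec, hJJ, Matrix.one_mulVec]
  have hn1 := LinearMap.finrank_range_add_finrank_ker (lmiM A C P).mulVecLin
  have hn2 := LinearMap.finrank_range_add_finrank_ker (J * W).mulVecLin
  have hn3 := Submodule.finrank_mono hker
  rw [← Matrix.rank] at hn1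
  simp only [Module.finrank_fintype_fun_eq_card, Fintype.card_sum, Fintype.card_fin] at hn1 hn2
  -- the kernel has dimension at least `k`, so the inclusion is an equality and `J W` is injective
  have hkereq := Submodule.eq_of_le_of_finrank_le hker (by omega)
  have hinj : Function.Injective (J * W).mulVecLin := by
    rw [← LinearMap.ker_eq_bot, ← Submodule.finrank_eq_zero]; omega
  have hzero : lmiM A C P * (J * W) = 0 := by
    apply Matrix.toLin'.injective
    refine LinearMap.ext fun x => ?_
    have : (J * W).mulVecLin x ∈ LinearMap.ker (lmiM A C P).mulVecLin := by
      rw [hkereq]; exact ⟨x, rfl⟩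
    have : lmiM A C P *ᵥ ((J * W) *ᵥ x) = 0 := this
    rw [Matrix.mulVec_mulVec] at this
    simpa [-Matrix.toLin'_mul] using this
  have hWW : J * W * (P * (Wᵀ * J * W)) = J * W * (1 : Matrix (Fin k) (Fin k) ℝ) := by
    rw [hM, Matrix.sub_mul, ← Matrix.mul_assoc J', hJJ', Matrix.one_mul, sub_eq_zero] at hzero
    have : W * (P * (Wᵀ * J * W)) = W := by
      simpa only [Matrix.mul_assoc] using hzero
    rw [Matrix.mul_assoc J, this, Matrix.mul_one]
  obtain ⟨U, hU, -⟩ := exists_leftInverse_of_injective (R := J * W) hinj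
  have h1 : P * (Wᵀ * J * W) = 1 := by
    have := congrArg (fun M => U * M) hWW
    simpa only [← Matrix.mul_assoc, hU, Matrix.one_mul, Matrix.mul_one] using this
  have h2 : P⁻¹ = Aᵀ * P⁻¹ * A - Cᵀ * C := by
    calc P⁻¹ = Wᵀ * J * W := Matrix.inv_eq_right_inv h1
      _ = _ := by
        rw [hW, hJ, transpose_fromRows, fromCols_mul_fromBlocks, fromCols_mul_fromRows]
        simp [sub_eq_add_neg]
  nth_rewrite 2 [h2]
  abel

/-- Every symmetric solution of the constrained linear matrix inequality has the form `R P' Rᵀ` with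
`P'` nonsingular and the column space of `R` invariant under `A`. -/
lemma exists_invariant_of_lmiSolution (hA : IsUnit (Aᵀ - 1).det)
    {X : Matrix (Fin n) (Fin n) ℝ} (hX : X.IsSymm) (hM : (lmiM A C X).PosSemidef) :
    ∃ (k : ℕ) (R : Matrix (Fin n) (Fin k) ℝ) (A' P' : Matrix (Fin k) (Fin k) ℝ),
      Function.Injective R.mulVec ∧ A * R = R * A' ∧ P'.IsSymm ∧ IsUnit P'.det ∧
        X = R * P' * Rᵀ := by
  have hS : (Aᵀᵀ * X * Aᵀ - X).PosSemidef := hM.submatrix Sum.inl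
  obtain ⟨k, R, hR, hRV⟩ : ∃ (k : ℕ) (R : Matrix (Fin n) (Fin k) ℝ), Function.Injective R.mulVec ∧
      ∀ x, x ∈ LinearMap.range X.mulVecLin ↔ ∃ y, R *ᵥ y = x := ⟨_, exists_basis_matrix _⟩
  have hmem : ∀ x, (∃ y, R *ᵥ y = x) ↔ ∃ y, X *ᵥ y = x := fun x => (hRV x).symm
  obtain ⟨V, hV⟩ := exists_mul_eq_of_range_le R X fun x => (hmem _).2 ⟨x, rfl⟩
  obtain ⟨Y, hY⟩ := exists_mul_eq_of_range_le X R fun x => (hmem _).1 ⟨x, rfl⟩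
  obtain ⟨U, hU, hUs⟩ := exists_leftInverse_of_injective hR
  have hRUX : R * U * X = X := by
    rw [hV, Matrix.mul_assoc, ← Matrix.mul_assoc U, hU, Matrix.one_mul]
  have hXRU : X * (R * U) = X := by
    have := congrArg transpose hRUX
    rwa [Matrix.transpose_mul, hUs.eq, hX.eq] at this
  have hXU : X = R * (U * X * Uᵀ) * Rᵀ := by
    calc X = R * U * X * (R * U)ᵀ := by rw [hRUX, hUs.eq, hXRU]
      _ = _ := by rw [Matrix.transpose_mul]; simp only [Matrix.mul_assoc]
  have hXA : X * (Aᵀ * (1 - R * U)) = 0 := by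
    apply Matrix.toLin'.injective
    refine LinearMap.ext fun x => ?_
    have h0 : X *ᵥ ((1 - R * U) *ᵥ x) = 0 := by
      rw [Matrix.mulVec_mulVec, Matrix.mul_sub, hXRU, Matrix.mul_one, sub_self, Matrix.zero_mulVec]
    have h1 := (ker_invariant hX hA hS h0).1
    rw [Matrix.mulVec_mulVec _ Aᵀ, Matrix.mulVec_mulVec] at h1
    simpa [-Matrix.toLin'_mul] using h1
  have hAX : (1 - R * U) * A * X = 0 := by
    have := congrArg transpose hXA
    simpa [Matrix.transpose_mul, hX.eq, hUs.eq] using this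
  have hAR : A * R = R * (U * A * R) := by
    have : (1 - R * U) * (A * R) = 0 := by
      nth_rewrite 2 [hY]
      rw [← Matrix.mul_assoc, ← Matrix.mul_assoc, hAX, Matrix.zero_mul]
    rw [Matrix.sub_mul, Matrix.one_mul, sub_eq_zero] at this
    rw [this]; simp only [Matrix.mul_assoc]
  refine ⟨_, R, U * A * R, U * X * Uᵀ, hR, hAR, ?_, ?_, hXU⟩
  · simp [Matrix.IsSymm, Matrix.transpose_mul, hX.eq, Matrix.mul_assoc]
  · have : U * X * Uᵀ * (Rᵀ * Y) = 1 := by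
      calc U * X * Uᵀ * (Rᵀ * Y) = (U * R) * (U * X * Uᵀ) * (Rᵀ * Y) := by
            rw [hU, Matrix.one_mul]
        _ = U * (R * (U * X * Uᵀ) * Rᵀ * Y) := by simp only [Matrix.mul_assoc]
        _ = 1 := by rw [← hXU, ← hY, hU]
    exact Matrix.isUnit_det_of_right_inverse this

/-- The matrix `M(P')` of the restricted system is a two-sided compression of `M(R P' Rᵀ)`. -/
lemma rank_lmiM_le {R : Matrix (Fin n) (Fin k) ℝ} {A' P' : Matrix (Fin k) (Fin k) ℝ}
    (hR : Function.Injective R.mulVec) (hA : A * R = R * A') :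
    (lmiM A' (C * R) P').rank ≤ (lmiM A C (R * P' * Rᵀ)).rank := by
  obtain ⟨U, hU, -⟩ := exists_leftInverse_of_injective hR
  have hUt : Rᵀ * Uᵀ = 1 := by rw [← Matrix.transpose_mul, hU, Matrix.transpose_one]
  have hA' : Rᵀ * Aᵀ = A'ᵀ * Rᵀ := by rw [← Matrix.transpose_mul, hA, Matrix.transpose_mul]
  have e : lmiM A' (C * R) P' =
      (fromBlocks U 0 0 1 : Matrix (Fin k ⊕ Fin m) (Fin n ⊕ Fin m) ℝ) * (lmiM A C (R * P' * Rᵀ) *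
        (fromBlocks Uᵀ 0 0 1 : Matrix (Fin n ⊕ Fin m) (Fin k ⊕ Fin m) ℝ)) := by
    rw [lmiM, lmiM, fromBlocks_multiply, fromBlocks_multiply]
    simp only [Matrix.mul_zero, Matrix.zero_mul, add_zero, zero_add, Matrix.mul_one,
      Matrix.one_mul]
    congr 1
    · calc A' * P' * A'ᵀ - P' = (U * R) * A' * P' * A'ᵀ * (Rᵀ * Uᵀ) - (U * R) * P' * (Rᵀ * Uᵀ) := by
            rw [hU, hUt]; simp only [Matrix.mul_one, Matrix.one_mul]
        _ = U * (R * A') * P' * (A'ᵀ * Rᵀ) * Uᵀ - U * R * P' * Rᵀ * Uᵀ := by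
            simp only [Matrix.mul_assoc]
        _ = _ := by
            rw [← hA, ← hA']; simp only [Matrix.mul_sub, Matrix.sub_mul, Matrix.mul_assoc]
    · calc A' * P' * (C * R)ᵀ = (U * R) * A' * P' * (C * R)ᵀ := by rw [hU, Matrix.one_mul]
        _ = U * (R * A') * P' * (C * R)ᵀ := by simp only [Matrix.mul_assoc]
        _ = _ := by rw [← hA, Matrix.transpose_mul]; simp only [Matrix.mul_assoc]
    · calc C * R * P' * A'ᵀ = C * R * P' * A'ᵀ * (Rᵀ * Uᵀ) := by rw [hUt, Matrix.mul_one]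
        _ = C * R * P' * (A'ᵀ * Rᵀ) * Uᵀ := by simp only [Matrix.mul_assoc]
        _ = _ := by rw [← hA']; simp only [Matrix.mul_assoc]
    · rw [Matrix.transpose_mul]; simp only [Matrix.mul_assoc]
  rw [e]
  exact (Matrix.rank_mul_le_right _ _).trans (Matrix.rank_mul_le_left _ _)

/-- Description of all left all-pass divisors of a minimally realized all-pass function. -/
theorem left_divisors (hmin : IsMinimalRealization A B C D) (hap : IsAllPass (transfer A B C D)) :
    ∃ P₀ : Matrix (Fin n) (Fin n) ℝ,
      IsSolP A B C D P₀ ∧ (∀ P, IsSolP A B C D P → P = P₀) ∧ IsUnit P₀ ∧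
      projFamily Aᵀ P₀ ⊆ lmiSolutionsP A C ∧
      (Unmixed A → projFamily Aᵀ P₀ = lmiSolutionsP A C) ∧
      (∀ P ∈ projFamily Aᵀ P₀, ∀ (G : Matrix (Fin n) (Fin m) ℝ) (L : Matrix (Fin m) (Fin m) ℝ),
          (fromCols Gᵀ Lᵀ).rank = m →
          lmiM A C P = (fromCols Gᵀ Lᵀ)ᵀ * fromCols Gᵀ Lᵀ →
          IsLeftAllPassDivisor (transfer A G C L) (transfer A B C D) ∧
          mcMillanDegree (transfer A G C L) = P.rank) ∧
      (∀ F : Matrix (Fin m) (Fin m) (RatFunc ℝ),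
        IsLeftAllPassDivisor F (transfer A B C D) →
        ∃ P ∈ projFamily Aᵀ P₀, ∃ (G : Matrix (Fin n) (Fin m) ℝ) (L : Matrix (Fin m) (Fin m) ℝ),
            (fromCols Gᵀ Lᵀ).rank = m ∧
            lmiM A C P = (fromCols Gᵀ Lᵀ)ᵀ * fromCols Gᵀ Lᵀ ∧
            F = transfer A G C L) := by
  have hobs := observable_of_isMinimalRealization hmin
  have hctr := controllable_of_isMinimalRealization hmin
  obtain ⟨P₀, hP₀, hu₀⟩ := exists_lossless_of_isAllPass hmin hap
  have hQ := hP₀.inv hu₀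
  have hst : Aᵀ * P₀⁻¹ * A - P₀⁻¹ = Cᵀ * C := hQ.state
  have hu : ∀ (k : ℕ) (R : Matrix (Fin n) (Fin k) ℝ) (A' : Matrix (Fin k) (Fin k) ℝ),
      Function.Injective R.mulVec → A * R = R * A' → IsUnit (Rᵀ * P₀⁻¹ * R).det :=
    fun k R A' hR hA => isUnit_det_restrict hobs hQ.symm hst hR hA
  have hinv : ∀ {k : ℕ} {M : Matrix (Fin k) (Fin k) ℝ}, IsUnit M.det → IsUnit M⁻¹ := by
    intro k M hM
    rw [Matrix.isUnit_iff_isUnit_det]; exact Matrix.isUnit_nonsing_inv_det _ hM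
  have hsub : projFamily Aᵀ P₀ ⊆ lmiSolutionsP A C := by
    intro X hX
    obtain ⟨k, R, A', hR, hA, rfl⟩ := (mem_projFamily_iff hu).1 hX
    have hK := isSymm_restrict hQ.symm R
    have hst' := stein_restrict hst hA
    obtain ⟨G, L, hGL⟩ := exists_lossless_completion hK (hu k R A' hR hA)
      (isUnit_sub_one hst' (hobs.restrict hR hA)) hst'
    have hM := lmiM_of_lossless hA hGL
    refine ⟨?_, ?_, ?_⟩
    · simpa using isSymm_restrict hK.inv Rᵀ
    · rw [hM, ← Matrix.conjTranspose_eq_transpose_of_trivial]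
      exact Matrix.posSemidef_conjTranspose_mul_self _
    · rw [hM, Matrix.rank_transpose_mul_self,
        rank_fromCols_of_lossless hR (hinv (hu k R A' hR hA)) hGL]
  refine ⟨P₀, isSolP_iff.2 hP₀, fun P hP => (isSolP_iff.1 hP).unique hobs hP₀, hu₀, hsub, ?_, ?_, ?_⟩
  · intro hmix
    refine hsub.antisymm ?_
    rintro X ⟨hX, hM, hrank⟩
    have hA1 : IsUnit (Aᵀ - 1).det := isUnit_sub_one (A := Aᵀ) (C := Bᵀ) hP₀.state hctr
    obtain ⟨k, R, A', P', hR, hA, hP', hPu, rfl⟩ := exists_invariant_of_lmiSolution hA1 hX hM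
    have h1 := stein_of_rank_le hPu ((rank_lmiM_le (C := C) (P' := P') hR hA).trans hrank.le)
    have h2 := stein_restrict hst hA
    have h3 : P'⁻¹ - Rᵀ * P₀⁻¹ * R = 0 := by
      apply hmix.eq_zero_of_stein hR hA
      rw [Matrix.mul_sub, Matrix.sub_mul, ← sub_eq_zero]
      rw [← h2, ← sub_eq_zero] at h1
      rw [← h1]; abel
    refine (mem_projFamily_iff hu).2 ⟨k, R, A', hR, hA, ?_⟩
    rw [← sub_eq_zero.1 h3, Matrix.nonsing_inv_nonsing_inv _ hPu]
  · intro X hX G L _ hM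
    obtain ⟨k, R, A', hR, hA, rfl⟩ := (mem_projFamily_iff hu).1 hX
    have hK := isSymm_restrict hQ.symm R
    obtain ⟨G', rfl, hGL⟩ := exists_lossless_of_lmiM hR hA hK.inv hM
    rw [rank_congruence hR (hinv (hu k R A' hR hA))]
    exact isLeftAllPassDivisor_of_lossless hmin hQ hR hA (hu k R A' hR hA) hGL
  · intro F hF
    obtain ⟨k, R, A', G, L, hR, hA, hGL, rfl⟩ := exists_invariant_of_isLeftAllPassDivisor hmin hQ hF
    exact ⟨_, (mem_projFamily_iff hu).2 ⟨k, R, A', hR, hA, rfl⟩, R * G, L,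
      rank_fromCols_of_lossless hR (hinv (hu k R A' hR hA)) hGL, lmiM_of_lossless hA hGL, rfl⟩

end Divisors

/-! ### Right all-pass divisors -/

section Duality

variable {n m : ℕ} {A : Matrix (Fin n) (Fin n) ℝ} {B : Matrix (Fin n) (Fin m) ℝ}
  {C : Matrix (Fin m) (Fin n) ℝ} {D : Matrix (Fin m) (Fin m) ℝ}

lemma transfer_transpose (A : Matrix (Fin n) (Fin n) ℝ) (B : Matrix (Fin n) (Fin m) ℝ)
    (C : Matrix (Fin m) (Fin n) ℝ) (D : Matrix (Fin m) (Fin m) ℝ) :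
    (transfer A B C D)ᵀ = transfer Aᵀ Cᵀ Bᵀ Dᵀ := by
  apply eq_of_eventually_evalAt
  filter_upwards [eventually_evalAt_transfer A B C D, eventually_evalAt_transfer Aᵀ Cᵀ Bᵀ Dᵀ]
    with z h1 h2
  rw [evalAt_transpose, h1, h2, tf_transpose]

lemma hasRealization_transpose_iff {k : ℕ} {F : Matrix (Fin m) (Fin m) (RatFunc ℝ)} :
    HasRealization Fᵀ k ↔ HasRealization F k :=
  ⟨fun h => by simpa using h.transpose, HasRealization.transpose⟩

lemma mcMillanDegree_transpose (F : Matrix (Fin m) (Fin m) (RatFunc ℝ)) :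
    mcMillanDegree Fᵀ = mcMillanDegree F := by
  simp only [mcMillanDegree, hasRealization_transpose_iff]

lemma IsAllPass.transpose {F : Matrix (Fin m) (Fin m) (RatFunc ℝ)} (h : IsAllPass F) :
    IsAllPass Fᵀ := by
  rw [isAllPass_iff] at h ⊢
  filter_upwards [tendsto_inv_cofinite.eventually h] with z hz
  rw [inv_inv, mul_eq_one_comm] at hz
  rw [evalAt_transpose, evalAt_transpose, Matrix.transpose_transpose, hz]

lemma IsRightAllPassDivisor.transpose {F₂ F : Matrix (Fin m) (Fin m) (RatFunc ℝ)}
    (h : IsRightAllPassDivisor F₂ F) : IsLeftAllPassDivisor F₂ᵀ Fᵀ := by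
  obtain ⟨F₁, rfl, ⟨k₁, h₁⟩, ⟨k₂, h₂⟩, h3, h4, h5⟩ := h
  refine ⟨F₁ᵀ, Matrix.transpose_mul _ _, ⟨k₂, h₂.transpose⟩, ⟨k₁, h₁.transpose⟩, h4.transpose,
    h3.transpose, ?_⟩
  rw [mcMillanDegree_transpose, mcMillanDegree_transpose, mcMillanDegree_transpose, h5, add_comm]

lemma IsLeftAllPassDivisor.transpose {F₁ F : Matrix (Fin m) (Fin m) (RatFunc ℝ)}
    (h : IsLeftAllPassDivisor F₁ F) : IsRightAllPassDivisor F₁ᵀ Fᵀ := by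
  obtain ⟨F₂, rfl, ⟨k₁, h₁⟩, ⟨k₂, h₂⟩, h3, h4, h5⟩ := h
  refine ⟨F₂ᵀ, Matrix.transpose_mul _ _, ⟨k₂, h₂.transpose⟩, ⟨k₁, h₁.transpose⟩, h4.transpose,
    h3.transpose, ?_⟩
  rw [mcMillanDegree_transpose, mcMillanDegree_transpose, mcMillanDegree_transpose, h5, add_comm]

lemma Unmixed.transpose (h : Unmixed A) : Unmixed Aᵀ := by
  have : spectrum ℂ (Aᵀ.map Complex.ofReal) = spectrum ℂ (A.map Complex.ofReal) := by
    ext a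
    rw [Matrix.mem_spectrum_iff_isRoot_charpoly, Matrix.mem_spectrum_iff_isRoot_charpoly,
      ← Matrix.charpoly_transpose, Matrix.transpose_map, Matrix.transpose_transpose]
  rwa [Unmixed, this]

/-- Description of all right all-pass divisors, by transposition. -/
theorem right_divisors (hmin : IsMinimalRealization A B C D) (hap : IsAllPass (transfer A B C D)) :
    ∃ Q₀ : Matrix (Fin n) (Fin n) ℝ,
      IsSolQ A B C D Q₀ ∧ (∀ Q, IsSolQ A B C D Q → Q = Q₀) ∧ IsUnit Q₀ ∧
      projFamily A Q₀ ⊆ lmiSolutionsQ A B ∧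
      (Unmixed A → projFamily A Q₀ = lmiSolutionsQ A B) ∧
      (∀ Q ∈ projFamily A Q₀, ∀ (H : Matrix (Fin m) (Fin n) ℝ) (J : Matrix (Fin m) (Fin m) ℝ),
          (fromCols H J).rank = m →
          lmiN A B Q = (fromCols H J)ᵀ * fromCols H J →
          IsRightAllPassDivisor (transfer A B H J) (transfer A B C D) ∧
          mcMillanDegree (transfer A B H J) = Q.rank) ∧
      (∀ F : Matrix (Fin m) (Fin m) (RatFunc ℝ),
        IsRightAllPassDivisor F (transfer A B C D) →
        ∃ Q ∈ projFamily A Q₀, ∃ (H : Matrix (Fin m) (Fin n) ℝ) (J : Matrix (Fin m) (Fin m) ℝ),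
            (fromCols H J).rank = m ∧
            lmiN A B Q = (fromCols H J)ᵀ * fromCols H J ∧
            F = transfer A B H J) := by
  have hmin' : IsMinimalRealization Aᵀ Cᵀ Bᵀ Dᵀ := by
    intro k hk
    rw [← transfer_transpose, hasRealization_transpose_iff] at hk
    exact hmin k hk
  have hap' : IsAllPass (transfer Aᵀ Cᵀ Bᵀ Dᵀ) := by
    rw [← transfer_transpose]; exact hap.transpose
  obtain ⟨Q₀, h1, h2, h3, h4, h5, h6, h7⟩ := left_divisors hmin' hap'
  refine ⟨Q₀, h1, h2, h3, h4, fun h => h5 h.transpose, ?_, ?_⟩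
  · intro Q hQ H J hr hN
    obtain ⟨d1, d2⟩ := h6 Q hQ Hᵀ Jᵀ hr hN
    have e : transfer Aᵀ Hᵀ Bᵀ Jᵀ = (transfer A B H J)ᵀ := (transfer_transpose A B H J).symm
    rw [e, mcMillanDegree_transpose] at d2
    rw [e, ← transfer_transpose] at d1
    exact ⟨by simpa using d1.transpose, d2⟩
  · intro F hF
    have hF' := hF.transpose
    rw [transfer_transpose] at hF'
    obtain ⟨Q, hQ, G, L, hr, hM, hFe⟩ := h7 Fᵀ hF'
    refine ⟨Q, hQ, Gᵀ, Lᵀ, hr, hM, ?_⟩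
    have := congrArg Matrix.transpose hFe
    rw [transfer_transpose] at this
    exact this

end Duality

end AllPass

theorem mainTheorem2 (n m : ℕ) (A : Matrix (Fin n) (Fin n) ℝ) (B : Matrix (Fin n) (Fin m) ℝ)
    (C : Matrix (Fin m) (Fin n) ℝ) (D : Matrix (Fin m) (Fin m) ℝ)
    (hmin : AllPass.IsMinimalRealization A B C D)
    (hap : AllPass.IsAllPass (AllPass.transfer A B C D)) :
    -- left divisors
    (∃ P₀ : Matrix (Fin n) (Fin n) ℝ,
      AllPass.IsSolP A B C D P₀ ∧ (∀ P, AllPass.IsSolP A B C D P → P = P₀) ∧ IsUnit P₀ ∧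
      AllPass.projFamily A.transpose P₀ ⊆ AllPass.lmiSolutionsP A C ∧
      (AllPass.Unmixed A → AllPass.projFamily A.transpose P₀ = AllPass.lmiSolutionsP A C) ∧
      (∀ P ∈ AllPass.projFamily A.transpose P₀,
        ∀ (G : Matrix (Fin n) (Fin m) ℝ) (L : Matrix (Fin m) (Fin m) ℝ),
          (Matrix.fromCols G.transpose L.transpose).rank = m →
          AllPass.lmiM A C P = (Matrix.fromCols G.transpose L.transpose).transpose *
            Matrix.fromCols G.transpose L.transpose →
          AllPass.IsLeftAllPassDivisor (AllPass.transfer A G C L) (AllPass.transfer A B C D) ∧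
          AllPass.mcMillanDegree (AllPass.transfer A G C L) = P.rank) ∧
      (∀ F : Matrix (Fin m) (Fin m) (RatFunc ℝ),
        AllPass.IsLeftAllPassDivisor F (AllPass.transfer A B C D) →
        ∃ P ∈ AllPass.projFamily A.transpose P₀,
          ∃ (G : Matrix (Fin n) (Fin m) ℝ) (L : Matrix (Fin m) (Fin m) ℝ),
            (Matrix.fromCols G.transpose L.transpose).rank = m ∧
            AllPass.lmiM A C P = (Matrix.fromCols G.transpose L.transpose).transpose *
              Matrix.fromCols G.transpose L.transpose ∧
            F = AllPass.transfer A G C L)) ∧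
    -- right divisors
    (∃ Q₀ : Matrix (Fin n) (Fin n) ℝ,
      AllPass.IsSolQ A B C D Q₀ ∧ (∀ Q, AllPass.IsSolQ A B C D Q → Q = Q₀) ∧ IsUnit Q₀ ∧
      AllPass.projFamily A Q₀ ⊆ AllPass.lmiSolutionsQ A B ∧
      (AllPass.Unmixed A → AllPass.projFamily A Q₀ = AllPass.lmiSolutionsQ A B) ∧
      (∀ Q ∈ AllPass.projFamily A Q₀,
        ∀ (H : Matrix (Fin m) (Fin n) ℝ) (J : Matrix (Fin m) (Fin m) ℝ),
          (Matrix.fromCols H J).rank = m →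
          AllPass.lmiN A B Q = (Matrix.fromCols H J).transpose * Matrix.fromCols H J →
          AllPass.IsRightAllPassDivisor (AllPass.transfer A B H J) (AllPass.transfer A B C D) ∧
          AllPass.mcMillanDegree (AllPass.transfer A B H J) = Q.rank) ∧
      (∀ F : Matrix (Fin m) (Fin m) (RatFunc ℝ),
        AllPass.IsRightAllPassDivisor F (AllPass.transfer A B C D) →
        ∃ Q ∈ AllPass.projFamily A Q₀,
          ∃ (H : Matrix (Fin m) (Fin n) ℝ) (J : Matrix (Fin m) (Fin m) ℝ),
            (Matrix.fromCols H J).rank = m ∧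
            AllPass.lmiN A B Q = (Matrix.fromCols H J).transpose * Matrix.fromCols H J ∧
            F = AllPass.transfer A B H J)) :=
  ⟨AllPass.left_divisors hmin hap, AllPass.right_divisors hmin hap⟩
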